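/- **Setting.** A *base sequence* is a sequence of integers $0=k_0<k_1<k_2<\cdots$; it is *special* if $k_{j+1}/k_j$, $j\ge 1$, is bounded. A *weight sequence* is a sequence $M=(M_j)_{j\ge0}$ of positive reals with $M_0=1\le M_1\le \mu_2\le\mu_3\le\cdots$, where $\mu_j=M_j/M_{j-1}$; put $m_j=M_j^{1/j}$ for $j\ge 1$ and $m_0=1$. Functions are real- or complex-valued. For a smooth function $f$ on an open subset of $\mathbb R^n$, an open subset $\Omega$ of its domain, $1\le p\le\infty$ and $C,\rho>0$ consider the estimates $$\|\partial^\alpha f\|_{L^p(\Omega)}\le C\,(\rho\, m_{|\alpha|})^{|\alpha|}.\qquad(*)$$ * $\mathcal B^{\{M\}}_{L^p}(\mathbb R^n)$ (respectively $\mathcal B^{(M)}_{L^p}(\mathbb R^n)$) is the set of $f\in C^\infty(\mathbb R^n)$ such that there are $C,\rho>0$ (respectively for every $\rho>0$ there is $C>0$) such that $(*)$ with $\Omega=\mathbb R^n$ holds for all multi-indices $\alpha\in\mathbb N^n$. * $\mathcal D^{\{M\}}(\mathbb R^n)$ (respectively $\mathcal D^{(M)}(\mathbb R^n)$) is the set of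 compactly supported functions in $\mathcal B^{\{M\}}_{L^\infty}(\mathbb R^n)$ (respectively $\mathcal B^{(M)}_{L^\infty}(\mathbb R^n)$). * For $U\subseteq\mathbb R^n$ open, $\mathcal E^{\{M\}}_{L^p}(U)$ (respectively $\mathcal E^{(M)}_{L^p}(U)$) is the set of $f\in C^\infty(U)$ such that for every open $\Omega$ whose closure is a compact subset of $U$ there are $C,\rho>0$ (respectively for every such $\Omega$ and every $\rho>0$ there is $C>0$) such that $(*)$ holds for all $\alpha\in\mathbb N^n$. The lacunary classes $\mathcal B^{[M]}_{L^p,(k_j)}(\mathbb R^n)$, $\mathcal D^{[M]}_{(k_j)}(\mathbb R^n)$, $\mathcal E^{[M]}_{L^p,(k_j)}(U)$ are defined in the same way, except that $(*)$ is required only for those $\alpha$ with $|\alpha|=k_j$ for some $j\ge0$. Here $[M]$ stands for either $\{M\}$ (Roumieu) or $(M)$ (Beurling). **Theorem.** Let $1\le p\le\infty$, let $(k_j)$ be a base sequence and $M$ a weight sequence such that $m_{k_{j+1}}/m_{k_j}$ is bounded. Then, in both the Roumieu and the Beurling case: (a) $\mathcal B^{[M]}_{L^p,(k_j)}(\mathbb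 R^n)=\mathcal B^{[M]}_{L^p}(\mathbb R^n)$. (b) $\mathcal D^{[M]}_{(k_j)}(\mathbb R^n)=\mathcal D^{[M]}(\mathbb R^n)$. If in addition $(k_j)$ is special and $U\subseteq\mathbb R^n$ is open, then: (c) $\mathcal E^{\{M\}}_{L^p,(k_j)}(U)=\mathcal E^{\{M\}}_{L^p}(U)$ provided that $j/m_j$ is bounded. (d) $\mathcal E^{(M)}_{L^p,(k_j)}(U)=\mathcal E^{(M)}_{L^p}(U)$ provided that $j/m_j\to0$ as $j\to\infty$. -/

import Mathlib

open Set Filter Topology MeasureTheory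
open scoped ENNReal ContDiff

noncomputable section

/-- A weight sequence: positive reals `M 0 = 1 ≤ M 1 ≤ μ 2 ≤ μ 3 ≤ ⋯`, where
`μ k = M k / M (k - 1)` (in particular `μ 1 = M 1`). -/
structure IsWeightSeq (M : ℕ → ℝ) : Prop where
  pos : ∀ k, 0 < M k
  zero : M 0 = 1
  one_le : 1 ≤ M 1
  quot_mono : ∀ k, M (k + 1) / M k ≤ M (k + 2) / M (k + 1)

/-- The sequence `m j = (M j) ^ (1 / j)`. (At `j = 0` a weight sequence gives the value `1`.) -/
def rootSeq (M : ℕ → ℝ) (j : ℕ) : ℝ := M j ^ (1 / (j : ℝ))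

/-- A base sequence: `0 = k 0 < k 1 < k 2 < ⋯`. -/
structure IsBaseSeq (k : ℕ → ℕ) : Prop where
  zero : k 0 = 0
  strictMono : StrictMono k

/-- A special base sequence: in addition `k (j + 1) / k j`, for `j ≥ 1`, is bounded. -/
structure IsSpecialBaseSeq (k : ℕ → ℕ) : Prop extends IsBaseSeq k where
  bdd : ∃ A : ℝ, ∀ j, 1 ≤ j → (k (j + 1) : ℝ) / (k j : ℝ) ≤ A

/-- The order `|α| = α_1 + ⋯ + α_n` of a multi-index. -/
def multiOrder {n : ℕ} (α : Fin n → ℕ) : ℕ := ∑ i, α i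

/-- The partial derivative `∂^α f (x)`: the derivative of order `|α|` of `f` at `x`, evaluated at
the list of vectors `e_1, …, e_1, e_2, …, e_2, …, e_n, …, e_n` in which the standard unit vector
`e_i` occurs `α_i` times. -/
def multiDeriv {𝕜 : Type*} [RCLike 𝕜] {n : ℕ} (α : Fin n → ℕ)
    (f : EuclideanSpace ℝ (Fin n) → 𝕜) (x : EuclideanSpace ℝ (Fin n)) : 𝕜 :=
  iteratedFDeriv ℝ (∑ i, α i) f x
    (fun s => EuclideanSpace.single (finSigmaFinEquiv.symm s).1 (1 : ℝ))

/-- The estimates `‖∂^α f‖_{L^p(Ω)} ≤ C (ρ m_{|α|})^{|α|}` for all multi-indices `α` whose order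
belongs to the set `S`. -/
def DCEstimates {𝕜 : Type*} [RCLike 𝕜] {n : ℕ} (p : ℝ≥0∞) (M : ℕ → ℝ) (S : Set ℕ)
    (Ω : Set (EuclideanSpace ℝ (Fin n))) (f : EuclideanSpace ℝ (Fin n) → 𝕜) (C ρ : ℝ) : Prop :=
  ∀ α : Fin n → ℕ, multiOrder α ∈ S →
    eLpNorm (multiDeriv α f) p (volume.restrict Ω) ≤
      ENNReal.ofReal (C * (ρ * rootSeq M (multiOrder α)) ^ multiOrder α)

/-- The two types of Denjoy-Carleman classes: Roumieu `{M}` and Beurling `(M)`. -/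
inductive DCType where
  | roumieu
  | beurling

/-- Quantification over the constants `C` and `ρ`: some `C, ρ > 0` in the Roumieu case; for every
`ρ > 0` some `C > 0` in the Beurling case. -/
def DCType.Constants : DCType → (ℝ → ℝ → Prop) → Prop
  | .roumieu, P => ∃ C : ℝ, 0 < C ∧ ∃ ρ : ℝ, 0 < ρ ∧ P C ρ
  | .beurling, P => ∀ ρ : ℝ, 0 < ρ → ∃ C : ℝ, 0 < C ∧ P C ρ

/-- Smooth functions on `ℝⁿ` satisfying the global estimates of type `t` for the orders in `S`. -/
def globalClassOn (𝕜 : Type*) [RCLike 𝕜] (n : ℕ) (t : DCType) (p : ℝ≥0∞) (M : ℕ → ℝ)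
    (S : Set ℕ) : Set (EuclideanSpace ℝ (Fin n) → 𝕜) :=
  {f | ContDiff ℝ ∞ f ∧ t.Constants (DCEstimates p M S univ f)}

/-- Smooth functions on `U` satisfying the local estimates of type `t` for the orders in `S`, on
every open relatively compact `Ω ⋐ U`. A function on `U` is represented by an arbitrary extension
to `ℝⁿ`: for open `U`, membership depends only on its values on `U`. -/
def localClassOn (𝕜 : Type*) [RCLike 𝕜] {n : ℕ} (t : DCType) (p : ℝ≥0∞) (M : ℕ → ℝ)
    (S : Set ℕ) (U : Set (EuclideanSpace ℝ (Fin n))) : Set (EuclideanSpace ℝ (Fin n) → 𝕜) :=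
  {f | ContDiffOn ℝ ∞ f U ∧
    ∀ Ω : Set (EuclideanSpace ℝ (Fin n)), IsOpen Ω → IsCompact (closure Ω) → closure Ω ⊆ U →
      t.Constants (DCEstimates p M S Ω f)}

/-- The global class `𝓑^{[M]}_{L^p}(ℝⁿ)`. -/
def classB (𝕜 : Type*) [RCLike 𝕜] (n : ℕ) (t : DCType) (p : ℝ≥0∞) (M : ℕ → ℝ) :
    Set (EuclideanSpace ℝ (Fin n) → 𝕜) :=
  globalClassOn 𝕜 n t p M univ

/-- The lacunary global class `𝓑^{[M]}_{L^p,(k_j)}(ℝⁿ)`. -/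
def lacunaryB (𝕜 : Type*) [RCLike 𝕜] (n : ℕ) (t : DCType) (p : ℝ≥0∞) (M : ℕ → ℝ)
    (k : ℕ → ℕ) : Set (EuclideanSpace ℝ (Fin n) → 𝕜) :=
  globalClassOn 𝕜 n t p M (range k)

/-- The class `𝓓^{[M]}(ℝⁿ)` of compactly supported elements of `𝓑^{[M]}_{L^∞}(ℝⁿ)`. -/
def classD (𝕜 : Type*) [RCLike 𝕜] (n : ℕ) (t : DCType) (M : ℕ → ℝ) :
    Set (EuclideanSpace ℝ (Fin n) → 𝕜) :=
  classB 𝕜 n t ⊤ M ∩ {f | HasCompactSupport f}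

/-- The lacunary class `𝓓^{[M]}_{(k_j)}(ℝⁿ)`. -/
def lacunaryD (𝕜 : Type*) [RCLike 𝕜] (n : ℕ) (t : DCType) (M : ℕ → ℝ) (k : ℕ → ℕ) :
    Set (EuclideanSpace ℝ (Fin n) → 𝕜) :=
  lacunaryB 𝕜 n t ⊤ M k ∩ {f | HasCompactSupport f}

/-- The local class `𝓔^{[M]}_{L^p}(U)`. -/
def classE (𝕜 : Type*) [RCLike 𝕜] {n : ℕ} (t : DCType) (p : ℝ≥0∞) (M : ℕ → ℝ)
    (U : Set (EuclideanSpace ℝ (Fin n))) : Set (EuclideanSpace ℝ (Fin n) → 𝕜) :=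
  localClassOn 𝕜 t p M univ U

/-- The lacunary local class `𝓔^{[M]}_{L^p,(k_j)}(U)`. -/
def lacunaryE (𝕜 : Type*) [RCLike 𝕜] {n : ℕ} (t : DCType) (p : ℝ≥0∞) (M : ℕ → ℝ)
    (k : ℕ → ℕ) (U : Set (EuclideanSpace ℝ (Fin n))) : Set (EuclideanSpace ℝ (Fin n) → 𝕜) :=
  localClassOn 𝕜 t p M (range k) U

end

/-! Only the passage from the orders `k j` to all orders needs proof. Let `k j ≤ l < k (j + 1)`.
Since `m_{k_{j+1}} ≤ A m_{k_j}`, the single number `T = A ρ m_{k_j}` serves at both ends: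
derivatives of orders `k j` and `k (j + 1)` are bounded by `C T ^ order`. It remains to interpolate,
and a loss `B ^ l` is harmless because it is absorbed into `ρ`, while `m_{k_j} ≤ m_l`.

The interpolation is numerical differentiation. Weights at nodes that reproduce the `i`-th
derivative at `0` of polynomials of degree at most `m`, rescaled to a step `ε` of order `1 / T`,
express the `i`-th derivative by values of the function and a Taylor remainder of order `m + 1`.
Minkowski's inequality carries this to `L^p` (`eLpNorm_deriv_le_of_nodes`).

On the whole space the gap `k (j + 1) - k j` may be far larger than `l`, so no constant may depend
on it. Weights of bounded mass for the second derivative give a Landau–Kolmogorov bound for the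
first one (`eLpNorm_first_deriv_le`), which is iterated one order at a time.

On an open set each use of the formula consumes room of size gap `/ T`, so it is used only once per
coordinate direction, with Lagrange weights costing a factor exponential in the gap
(`eLpNorm_local_deriv_le`). For a special base sequence the gap is at most `k 1 + D l`, so this cost
is again of the form const `* B ^ l`. The hypotheses on `j / m_j` keep the consumed room below the
distance available. -/

noncomputable section

/-! ### Mixed partial derivatives as iterated directional derivatives. -/

section Directional

variable {𝕜 : Type*} [RCLike 𝕜] {n : ℕ}

/-- Iterated directional derivatives along the standard unit vectors, the head of the list being
applied last. -/
def dirDeriv (f : EuclideanSpace ℝ (Fin n) → 𝕜) : List (Fin n) → EuclideanSpace ℝ (Fin n) → 𝕜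
  | [] => f
  | i :: l => fun x => fderiv ℝ (dirDeriv f l) x (EuclideanSpace.single i 1)

theorem ContDiffOn.dirDeriv {f : EuclideanSpace ℝ (Fin n) → 𝕜} {U : Set (EuclideanSpace ℝ (Fin n))}
    (hU : IsOpen U) (hf : ContDiffOn ℝ ∞ f U) (l : List (Fin n)) :
    ContDiffOn ℝ ∞ (dirDeriv f l) U := by
  induction l with
  | nil => exact hf
  | cons i l ih =>
    exact (ih.fderiv_of_isOpen hU (m := ∞) (by simp)).clm_apply contDiffOn_const

theorem dirDeriv_perm {f : EuclideanSpace ℝ (Fin n) → 𝕜} {U : Set (EuclideanSpace ℝ (Fin n))}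
    (hU : IsOpen U) (hf : ContDiffOn ℝ ∞ f U) {l l' : List (Fin n)} (h : l.Perm l') :
    EqOn (dirDeriv f l) (dirDeriv f l') U := by
  induction h with
  | nil => exact fun _ _ => rfl
  | cons i h ih =>
    intro x hx
    have : _root_.dirDeriv f _ =ᶠ[𝓝 x] _root_.dirDeriv f _ :=
      Filter.eventuallyEq_of_mem (hU.mem_nhds hx) ih
    simp only [_root_.dirDeriv, this.fderiv_eq]
  | swap i j l =>
    intro x hx
    have hg : ContDiffAt ℝ ∞ (_root_.dirDeriv f l) x :=
      (hf.dirDeriv hU l).contDiffAt (hU.mem_nhds hx)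
    have hs : IsSymmSndFDerivAt ℝ (_root_.dirDeriv f l) x :=
      hg.isSymmSndFDerivAt (by
        rw [minSmoothness_of_isRCLikeNormedField]
        exact ENat.LEInfty.out)
    have hd : DifferentiableAt ℝ (fderiv ℝ (_root_.dirDeriv f l)) x :=
      (hg.fderiv_right (m := ∞) (by simp)).differentiableAt (by simp)
    simp only [_root_.dirDeriv]
    rw [fderiv_clm_apply hd (differentiableAt_const _),
      fderiv_clm_apply hd (differentiableAt_const _)]
    simpa using hs _ _
  | trans _ _ ih₁ ih₂ => exact ih₁.trans ih₂

theorem iteratedFDeriv_single_eq_dirDeriv {f : EuclideanSpace ℝ (Fin n) → 𝕜}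
    {U : Set (EuclideanSpace ℝ (Fin n))} (hU : IsOpen U) (hf : ContDiffOn ℝ ∞ f U) (N : ℕ)
    (v : Fin N → Fin n) :
    EqOn (fun x => iteratedFDeriv ℝ N f x (fun s => EuclideanSpace.single (v s) (1 : ℝ)))
      (dirDeriv f (List.ofFn v)) U := by
  induction N with
  | zero => intro x _; simp [dirDeriv]
  | succ N ih =>
    intro x hx
    have hd : DifferentiableAt ℝ (iteratedFDeriv ℝ N f) x :=
      (hf.contDiffAt (hU.mem_nhds hx)).differentiableAt_iteratedFDeriv
        (by exact_mod_cast WithTop.coe_lt_coe.2 (ENat.natCast_lt_top N))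
    have he := Filter.eventuallyEq_of_mem (hU.mem_nhds hx) (ih (fun s => v s.succ))
    simp only [List.ofFn_succ, dirDeriv]
    rw [← he.fderiv_eq, hd.iteratedFDeriv_succ_apply_left']
    rfl

theorem count_ofFn_sigma (α : Fin n → ℕ) (i : Fin n) :
    (List.ofFn fun s : Fin (∑ i, α i) => (finSigmaFinEquiv.symm s).1).count i = α i := by
  classical
  rw [← Multiset.coe_count, ← Fin.univ_val_map, Multiset.count_map, ← Finset.filter_val,
    Finset.card_val]
  have : (Finset.univ.filter fun s : Fin (∑ i, α i) => i = (finSigmaFinEquiv.symm s).1) =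
      (Finset.univ : Finset (Fin (α i))).map
        ⟨fun r => finSigmaFinEquiv ⟨i, r⟩, fun r r' h => by simpa using h⟩ := by
    ext s
    obtain ⟨⟨j, r⟩, rfl⟩ := finSigmaFinEquiv.surjective s
    simp only [Finset.mem_filter, Finset.mem_univ, true_and, Equiv.symm_apply_apply,
      Finset.mem_map]
    constructor
    · rintro rfl; exact ⟨r, rfl⟩
    · rintro ⟨r', h⟩
      exact congrArg Sigma.fst (finSigmaFinEquiv.injective h)
  rw [this, Finset.card_map, Finset.card_univ, Fintype.card_fin]

/-- The definition of `multiDeriv` lists the directions in increasing order. Freedom in the choice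
of `l` allows a new direction to be put at the head, where it acts as one more derivative. -/
theorem multiDeriv_eq_dirDeriv {f : EuclideanSpace ℝ (Fin n) → 𝕜}
    {U : Set (EuclideanSpace ℝ (Fin n))} (hU : IsOpen U) (hf : ContDiffOn ℝ ∞ f U)
    (α : Fin n → ℕ) (l : List (Fin n)) (hl : ∀ i, l.count i = α i) :
    EqOn (multiDeriv α f) (dirDeriv f l) U :=
  (iteratedFDeriv_single_eq_dirDeriv hU hf _ _).trans <| dirDeriv_perm hU hf <|
    List.perm_iff_count.2 fun i => by rw [hl, count_ofFn_sigma]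

theorem ContDiffOn.multiDeriv {f : EuclideanSpace ℝ (Fin n) → 𝕜}
    {U : Set (EuclideanSpace ℝ (Fin n))} (hU : IsOpen U) (hf : ContDiffOn ℝ ∞ f U)
    (α : Fin n → ℕ) : ContDiffOn ℝ ∞ (multiDeriv α f) U :=
  (hf.dirDeriv hU _).congr (multiDeriv_eq_dirDeriv hU hf α _ (count_ofFn_sigma α))

theorem hasDerivAt_multiDeriv {f : EuclideanSpace ℝ (Fin n) → 𝕜}
    {U : Set (EuclideanSpace ℝ (Fin n))} (hU : IsOpen U) (hf : ContDiffOn ℝ ∞ f U)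
    (α : Fin n → ℕ) (i : Fin n) (x : EuclideanSpace ℝ (Fin n)) (u : ℝ)
    (hx : x + u • EuclideanSpace.single i (1 : ℝ) ∈ U) :
    HasDerivAt (fun u : ℝ => multiDeriv α f (x + u • EuclideanSpace.single i (1 : ℝ)))
      (multiDeriv (α + Pi.single i 1) f (x + u • EuclideanSpace.single i (1 : ℝ))) u := by
  set l := List.ofFn fun s : Fin (∑ i, α i) => (finSigmaFinEquiv.symm s).1 with hl
  have h1 := multiDeriv_eq_dirDeriv hU hf α l (count_ofFn_sigma α)
  have h2 := multiDeriv_eq_dirDeriv hU hf (α + Pi.single i 1) (i :: l) (fun j => by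
    rw [List.count_cons, hl, count_ofFn_sigma]
    by_cases h : i = j
    · subst h; simp
    · simp [h, Ne.symm h])
  have hd := ((hf.multiDeriv hU α).contDiffAt (hU.mem_nhds hx)).differentiableAt
    (by simp) |>.hasFDerivAt
  have hl' : HasDerivAt (fun u : ℝ => x + u • EuclideanSpace.single i (1 : ℝ))
      (EuclideanSpace.single i (1 : ℝ)) u := by
    simpa using ((hasDerivAt_id u).smul_const (EuclideanSpace.single i (1 : ℝ))).const_add x
  have := hd.comp_hasDerivAt u hl'
  simp only [h2 hx, dirDeriv]
  rw [← (Filter.eventuallyEq_of_mem (hU.mem_nhds hx) h1).fderiv_eq]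
  exact this

end Directional

/-! ### Numerical differentiation on the line, with Taylor remainder. -/

section Taylor

variable {𝕜 : Type*} [RCLike 𝕜]

/-- The Taylor polynomial is differentiated in its base point, where the product rule telescopes.
Integrating from `0` to `t` gives the remainder in integral form. -/
theorem hasDerivAt_taylor_sum {G : ℕ → ℝ → 𝕜} {u : ℝ}
    (hG : ∀ s, HasDerivAt (G s) (G (s + 1) u) u) (t : ℝ) (m : ℕ) :
    HasDerivAt (fun u => ∑ s ∈ Finset.range (m + 1), ((t - u) ^ s / (s.factorial : ℝ)) • G s u)
      (((t - u) ^ m / (m.factorial : ℝ)) • G (m + 1) u) u := by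
  induction m with
  | zero => simpa using hG 0
  | succ m ih =>
    simp_rw [Finset.sum_range_succ _ (m + 1)]
    have h1 : HasDerivAt (fun u : ℝ => (t - u) ^ (m + 1) / ((m + 1).factorial : ℝ))
        (-((t - u) ^ m / (m.factorial : ℝ))) u := by
      have := (((hasDerivAt_id u).const_sub t).pow (m + 1)).div_const ((m + 1).factorial : ℝ)
      refine this.congr_deriv ?_
      have : (m.factorial : ℝ) ≠ 0 := by positivity
      simp only [id, Nat.factorial_succ]
      push_cast
      field_simp
    refine (ih.add (h1.smul (hG (m + 1)))).congr_deriv ?_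
    simp only [neg_smul]
    ring

/-- The bound is deliberately independent of `t`: one integral over the symmetric interval dominates
the remainders at all nodes simultaneously. -/
theorem enorm_sub_taylor_le {G : ℕ → ℝ → 𝕜} {R t : ℝ} (ht : |t| ≤ R)
    (hG : ∀ s, ∀ u ∈ Icc (-R) R, HasDerivAt (G s) (G (s + 1) u) u) (m : ℕ) :
    ‖G 0 t - ∑ s ∈ Finset.range (m + 1), (t ^ s / (s.factorial : ℝ)) • G s 0‖ₑ ≤
      ENNReal.ofReal (R ^ m / (m.factorial : ℝ)) * ∫⁻ u in Icc (-R) R, ‖G (m + 1) u‖ₑ := by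
  have hR : 0 ≤ R := (abs_nonneg t).trans ht
  have hsub : uIcc 0 t ⊆ Icc (-R) R := by
    rw [abs_le] at ht
    exact uIcc_subset_Icc ⟨by linarith, hR⟩ ht
  have hcont : ContinuousOn (fun u => ((t - u) ^ m / (m.factorial : ℝ)) • G (m + 1) u)
      (uIcc 0 t) := by
    refine ContinuousOn.smul (by fun_prop) fun u hu => ?_
    exact (hG (m + 1) u (hsub hu)).continuousAt.continuousWithinAt
  have key := intervalIntegral.integral_eq_sub_of_hasDerivAt
    (fun u hu => hasDerivAt_taylor_sum (fun s => hG s u (hsub hu)) t m) hcont.intervalIntegrable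
  have h0 : ∑ s ∈ Finset.range (m + 1), ((t - t) ^ s / (s.factorial : ℝ)) • G s t = G 0 t := by
    rw [Finset.sum_range_succ']
    simp
  simp only [h0, sub_zero] at key
  rw [← key, intervalIntegral.intervalIntegral_eq_integral_uIoc, enorm_smul]
  have h1 : ‖(if 0 ≤ t then (1 : ℝ) else -1)‖ₑ = 1 := by split_ifs <;> simp
  rw [h1, one_mul]
  refine (enorm_integral_le_lintegral_enorm _).trans ?_
  rw [← lintegral_const_mul' _ _ ENNReal.ofReal_ne_top]
  have hsub' : uIoc 0 t ⊆ Icc (-R) R := uIoc_subset_uIcc.trans hsub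
  refine (setLIntegral_mono' measurableSet_uIoc (g := fun u =>
    ENNReal.ofReal (R ^ m / (m.factorial : ℝ)) * ‖G (m + 1) u‖ₑ) fun u hu => ?_).trans
    (lintegral_mono_set hsub')
  rw [enorm_smul]
  gcongr
  rw [← ofReal_norm, norm_div, norm_pow, Real.norm_eq_abs, Real.norm_natCast]
  refine ENNReal.ofReal_le_ofReal ?_
  gcongr
  have := abs_sub_right_of_mem_uIcc (uIoc_subset_uIcc hu)
  simp only [sub_zero] at this
  exact this.trans ht

/-- The moment conditions `hw` say that the weights reproduce the `i`-th derivative at `0` on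
polynomials of degree at most `m`. Scaling the nodes by `ε` divides the weights by `ε ^ i`. The
formula is exact on the Taylor polynomial of `G 0`, whose node values differ from those of `G 0` by
the remainder. -/
theorem enorm_deriv_le_of_nodes {ι : Type*} (J : Finset ι) (w t : ι → ℝ) {i m : ℕ} (hi : i ≤ m)
    (hw : ∀ s ≤ m, ∑ j ∈ J, w j * t j ^ s = if s = i then (i.factorial : ℝ) else 0)
    {τ W ε : ℝ} (ht : ∀ j ∈ J, |t j| ≤ τ) (hW : ∑ j ∈ J, |w j| ≤ W) (hε : 0 < ε)
    {G : ℕ → ℝ → 𝕜} (hG : ∀ s, ∀ u ∈ Icc (-(ε * τ)) (ε * τ), HasDerivAt (G s) (G (s + 1) u) u) :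
    ‖G i 0‖ₑ ≤ ∑ j ∈ J, ENNReal.ofReal (|w j| / ε ^ i) * ‖G 0 (ε * t j)‖ₑ +
      ENNReal.ofReal (W / ε ^ i) * (ENNReal.ofReal ((ε * τ) ^ m / (m.factorial : ℝ)) *
        ∫⁻ u in Icc (-(ε * τ)) (ε * τ), ‖G (m + 1) u‖ₑ) := by
  set I := ∫⁻ u in Icc (-(ε * τ)) (ε * τ), ‖G (m + 1) u‖ₑ
  set P : ι → 𝕜 := fun j =>
    ∑ s ∈ Finset.range (m + 1), ((ε * t j) ^ s / (s.factorial : ℝ)) • G s 0 with hP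
  have hrep : G i 0 = ∑ j ∈ J, (w j / ε ^ i) • P j := by
    simp only [hP, Finset.smul_sum, smul_smul]
    rw [Finset.sum_comm]
    simp only [← Finset.sum_smul]
    have h1 : ∀ s ∈ Finset.range (m + 1),
        (∑ j ∈ J, w j / ε ^ i * ((ε * t j) ^ s / (s.factorial : ℝ))) • G s 0 =
          if s = i then G i 0 else 0 := by
      intro s hs
      have h2 : ∑ j ∈ J, w j / ε ^ i * ((ε * t j) ^ s / (s.factorial : ℝ)) =
          ε ^ s / ε ^ i / (s.factorial : ℝ) * ∑ j ∈ J, w j * t j ^ s := by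
        rw [Finset.mul_sum]
        refine Finset.sum_congr rfl fun j _ => ?_
        rw [mul_pow]; ring
      rw [h2, hw s (by simpa [Nat.lt_succ_iff] using hs)]
      split_ifs with h
      · subst h
        have : (s.factorial : ℝ) ≠ 0 := by positivity
        rw [div_self (by positivity), one_div, inv_mul_cancel₀ this, one_smul]
      · simp
    rw [Finset.sum_congr rfl h1, Finset.sum_ite_eq' _ _ (fun _ => G i 0)]
    simp [hi]
  have hPj : ∀ j ∈ J, ‖P j‖ₑ ≤ ‖G 0 (ε * t j)‖ₑ +
      ENNReal.ofReal ((ε * τ) ^ m / (m.factorial : ℝ)) * I := by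
    intro j hj
    have h := enorm_sub_taylor_le (t := ε * t j) (R := ε * τ)
      (by rw [abs_mul, abs_of_pos hε]; gcongr; exact ht j hj) hG m
    calc ‖P j‖ₑ = ‖G 0 (ε * t j) - (G 0 (ε * t j) - P j)‖ₑ := by rw [sub_sub_cancel]
      _ ≤ ‖G 0 (ε * t j)‖ₑ + ‖G 0 (ε * t j) - P j‖ₑ := enorm_sub_le
      _ ≤ _ := by gcongr
  rw [hrep]
  refine (enorm_sum_le _ _).trans ?_
  calc ∑ j ∈ J, ‖(w j / ε ^ i) • P j‖ₑ
      ≤ ∑ j ∈ J, ENNReal.ofReal (|w j| / ε ^ i) * (‖G 0 (ε * t j)‖ₑ +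
      ENNReal.ofReal ((ε * τ) ^ m / (m.factorial : ℝ)) * I) := by
        refine Finset.sum_le_sum fun j hj => ?_
        rw [enorm_smul, ← ofReal_norm, Real.norm_eq_abs, abs_div,
          abs_of_pos (pow_pos hε i)]
        gcongr
        exact hPj j hj
    _ = ∑ j ∈ J, ENNReal.ofReal (|w j| / ε ^ i) * ‖G 0 (ε * t j)‖ₑ +
        ENNReal.ofReal ((∑ j ∈ J, |w j|) / ε ^ i) *
          (ENNReal.ofReal ((ε * τ) ^ m / (m.factorial : ℝ)) * I) := by
        rw [Finset.sum_div, ENNReal.ofReal_sum_of_nonneg (fun j _ => by positivity),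
          Finset.sum_mul, ← Finset.sum_add_distrib]
        exact Finset.sum_congr rfl fun j _ => mul_add _ _ _
    _ ≤ _ := by gcongr

end Taylor

/-! ### Integrals of translates in `L^p`. -/

section Minkowski

variable {E : Type*} [NormedAddCommGroup E] [NormedSpace ℝ E] [MeasurableSpace E] [BorelSpace E]
  [SecondCountableTopology E] {μ : Measure E} [SigmaFinite μ] [μ.IsAddHaarMeasure]

theorem eLpNorm_translate_le {E : Type*} [NormedAddCommGroup E] [MeasurableSpace E] [BorelSpace E]
    {μ : Measure E} [μ.IsAddHaarMeasure] {G : E → ℝ≥0∞} (hG : Measurable G) {p : ℝ≥0∞} {Ω Ω' : Set E}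
    (hΩ : MeasurableSet Ω) (hΩ' : MeasurableSet Ω') {y : E} (h : ∀ x ∈ Ω, x + y ∈ Ω') :
    eLpNorm (fun x => G (x + y)) p (μ.restrict Ω) ≤ eLpNorm G p (μ.restrict Ω') := by
  have h1 := eLpNorm_comp_measurePreserving (p := p)
    (hG.indicator hΩ').aestronglyMeasurable (measurePreserving_add_right μ y)
  rw [← eLpNorm_indicator_eq_eLpNorm_restrict hΩ', ← h1,
    ← eLpNorm_indicator_eq_eLpNorm_restrict hΩ]
  refine eLpNorm_mono_enorm fun x => ?_
  by_cases hx : x ∈ Ω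
  · simp [hx, h x hx]
  · simp [hx]

/-- Minkowski's integral inequality along a segment. For `p = ∞` the exceptional null sets are
exchanged by Fubini; for finite `p` Hölder's inequality in `u` is followed by Tonelli. -/
theorem eLpNorm_lintegral_translate_le {G : E → ℝ≥0∞} (hG : Measurable G) {p : ℝ≥0∞} (hp : 1 ≤ p)
    {Ω Ω' : Set E} (hΩ : MeasurableSet Ω) (hΩ' : MeasurableSet Ω') {v : E} {R : ℝ}
    (h : ∀ x ∈ Ω, ∀ u ∈ Icc (-R) R, x + u • v ∈ Ω') :
    eLpNorm (fun x => ∫⁻ u in Icc (-R) R, G (x + u • v)) p (μ.restrict Ω) ≤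
      ENNReal.ofReal (2 * R) * eLpNorm G p (μ.restrict Ω') := by
  have hmeas : Measurable (fun z : E × ℝ => G (z.1 + z.2 • v)) := by
    refine hG.comp ?_
    fun_prop
  have hvol : volume.restrict (Icc (-R) R) univ = ENNReal.ofReal (2 * R) := by
    simp [two_mul]
  have htr : ∀ u ∈ Icc (-R) R, eLpNorm (fun x => G (x + u • v)) p (μ.restrict Ω) ≤
      eLpNorm G p (μ.restrict Ω') := fun u hu =>
    eLpNorm_translate_le hG hΩ hΩ' fun x hx => h x hx u hu
  rcases eq_or_ne p ⊤ with rfl | hpt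
  · set S := eLpNorm G ⊤ (μ.restrict Ω') with hS
    have hset : MeasurableSet {z : E × ℝ | G (z.1 + z.2 • v) ≤ S} :=
      measurableSet_le hmeas measurable_const
    have h1 : ∀ᵐ u ∂(volume.restrict (Icc (-R) R)), ∀ᵐ x ∂(μ.restrict Ω), G (x + u • v) ≤ S := by
      refine (ae_restrict_iff' measurableSet_Icc).2 (ae_of_all _ fun u hu => ?_)
      have h2 := enorm_ae_le_eLpNormEssSup (fun x => G (x + u • v)) (μ.restrict Ω)
      filter_upwards [h2] with x hx
      exact hx.trans (by simpa using htr u hu)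
    have h3 : ∀ᵐ x ∂(μ.restrict Ω), ∀ᵐ u ∂(volume.restrict (Icc (-R) R)), G (x + u • v) ≤ S :=
      (Measure.ae_ae_comm hset).2 h1
    rw [eLpNorm_exponent_top]
    refine essSup_le_of_ae_le _ ?_
    filter_upwards [h3] with x hx
    refine (lintegral_mono_ae hx).trans ?_
    rw [lintegral_const, hvol, mul_comm]
  · have hp0 : p ≠ 0 := (zero_lt_one.trans_le hp).ne'
    set r := p.toReal with hr
    have hr0 : 0 < r := ENNReal.toReal_pos hp0 hpt
    have hr1 : 1 ≤ r := by
      rw [hr, ← ENNReal.toReal_one]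
      exact (ENNReal.toReal_le_toReal (by simp) hpt).2 hp
    set L := ENNReal.ofReal (2 * R) with hL
    have hLt : L ≠ ⊤ := ENNReal.ofReal_ne_top
    have hpt' : ∀ x, (∫⁻ u in Icc (-R) R, G (x + u • v)) ^ r ≤
        L ^ (r - 1) * ∫⁻ u in Icc (-R) R, G (x + u • v) ^ r := by
      intro x
      have h1 := eLpNorm_le_eLpNorm_mul_rpow_measure_univ (μ := volume.restrict (Icc (-R) R)) hp
        (f := fun u : ℝ => G (x + u • v))
        (hG.comp (by fun_prop : Measurable fun u : ℝ => x + u • v)).aestronglyMeasurable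
      rw [eLpNorm_one_eq_lintegral_enorm, eLpNorm_eq_lintegral_rpow_enorm_toReal hp0 hpt, hvol] at h1
      simp only [enorm_eq_self, ENNReal.toReal_one, ← hr] at h1
      refine (ENNReal.rpow_le_rpow h1 hr0.le).trans (le_of_eq ?_)
      rw [ENNReal.mul_rpow_of_nonneg _ _ hr0.le, ← ENNReal.rpow_mul, ← ENNReal.rpow_mul,
        one_div_mul_cancel hr0.ne', ENNReal.rpow_one, mul_comm]
      congr 2
      field_simp
    have hswap : ∫⁻ x in Ω, (∫⁻ u in Icc (-R) R, G (x + u • v) ^ r) ∂μ ≤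
        L * ∫⁻ x in Ω', G x ^ r ∂μ := by
      rw [lintegral_lintegral_swap (by exact (hmeas.pow_const r).aemeasurable), ← hvol,
        mul_comm, ← lintegral_const]
      refine setLIntegral_mono' measurableSet_Icc fun u hu => ?_
      have h1 := htr u hu
      rw [eLpNorm_eq_lintegral_rpow_enorm_toReal hp0 hpt,
        eLpNorm_eq_lintegral_rpow_enorm_toReal hp0 hpt,
        ENNReal.rpow_le_rpow_iff (by positivity)] at h1
      simpa using h1
    rw [eLpNorm_eq_lintegral_rpow_enorm_toReal hp0 hpt,
      eLpNorm_eq_lintegral_rpow_enorm_toReal hp0 hpt]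
    simp only [enorm_eq_self, ← hr]
    have h5 : L = (L ^ r) ^ (1 / r) := by
      rw [← ENNReal.rpow_mul, mul_one_div_cancel hr0.ne', ENNReal.rpow_one]
    conv_rhs => rw [h5]
    rw [← ENNReal.mul_rpow_of_nonneg _ _ (by positivity)]
    refine ENNReal.rpow_le_rpow ?_ (by positivity)
    calc ∫⁻ x in Ω, (∫⁻ u in Icc (-R) R, G (x + u • v)) ^ r ∂μ
        ≤ ∫⁻ x in Ω, (L ^ (r - 1) * ∫⁻ u in Icc (-R) R, G (x + u • v) ^ r) ∂μ :=
          lintegral_mono hpt'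
      _ = L ^ (r - 1) * ∫⁻ x in Ω, (∫⁻ u in Icc (-R) R, G (x + u • v) ^ r) ∂μ :=
          lintegral_const_mul' _ _ (ENNReal.rpow_ne_top_of_nonneg (by linarith) hLt)
      _ ≤ L ^ (r - 1) * (L * ∫⁻ x in Ω', G x ^ r ∂μ) := by gcongr
      _ = L ^ r * ∫⁻ x in Ω', G x ^ r ∂μ := by
          rw [← mul_assoc]
          congr 1
          nth_rewrite 2 [← ENNReal.rpow_one L]
          rw [← ENNReal.rpow_add_of_nonneg _ _ (by linarith) zero_le_one]
          congr 1; ring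

end Minkowski

/-! ### The numerical differentiation estimate in `L^p`. -/

section Nodes

variable {𝕜 : Type*} [RCLike 𝕜]
  {E : Type*} [NormedAddCommGroup E] [NormedSpace ℝ E] [MeasurableSpace E] [BorelSpace E]
  [SecondCountableTopology E] {μ : Measure E} [SigmaFinite μ] [μ.IsAddHaarMeasure]

theorem eLpNorm_deriv_le_of_nodes {ι : Type*} (J : Finset ι) (w t : ι → ℝ) {i m : ℕ} (hi : i ≤ m)
    (hw : ∀ s ≤ m, ∑ j ∈ J, w j * t j ^ s = if s = i then (i.factorial : ℝ) else 0)
    {τ W ε : ℝ} (ht : ∀ j ∈ J, |t j| ≤ τ) (hW : ∑ j ∈ J, |w j| ≤ W) (hε : 0 < ε) (hτ : 0 ≤ τ)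
    {p : ℝ≥0∞} (hp : 1 ≤ p) {v : E} {F : ℕ → E → 𝕜} {Ω Ω' : Set E} (hΩ : IsOpen Ω)
    (hΩ' : IsOpen Ω') (hF : ∀ s, ContinuousOn (F s) Ω')
    (hd : ∀ s x, ∀ u : ℝ, x + u • v ∈ Ω' →
      HasDerivAt (fun u : ℝ => F s (x + u • v)) (F (s + 1) (x + u • v)) u)
    (hsub : ∀ x ∈ Ω, ∀ u : ℝ, |u| ≤ ε * τ → x + u • v ∈ Ω') :
    eLpNorm (F i) p (μ.restrict Ω) ≤ ENNReal.ofReal (W / ε ^ i) *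
      (eLpNorm (F 0) p (μ.restrict Ω') +
        ENNReal.ofReal (2 * (ε * τ) ^ (m + 1) / (m.factorial : ℝ)) *
          eLpNorm (F (m + 1)) p (μ.restrict Ω')) := by
  -- `F s` is controlled only on `Ω'`; cutting its norm off there gives a function measurable on all
  -- of `E`, as translation requires.
  set G : ℕ → E → ℝ≥0∞ := fun s => Ω'.indicator fun x => ‖F s x‖ₑ with hGdef
  have hG : ∀ s, Measurable (G s) := fun s => by
    classical
    have h1 := (hF s).enorm.measurable_piecewise (continuousOn_const (c := (0 : ℝ≥0∞)))
      hΩ'.measurableSet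
    simp only [hGdef]
    rwa [← piecewise_eq_indicator]
  have hGF : ∀ s, eLpNorm (G s) p (μ.restrict Ω') = eLpNorm (F s) p (μ.restrict Ω') := by
    intro s
    refine eLpNorm_congr_enorm_ae ?_
    refine (ae_restrict_iff' hΩ'.measurableSet).2 (ae_of_all _ fun x hx => ?_)
    simp [hGdef, hx]
  have hετ : 0 ≤ ε * τ := by positivity
  set K := ENNReal.ofReal ((ε * τ) ^ m / (m.factorial : ℝ)) with hK
  set A : ι → E → ℝ≥0∞ := fun j x => ENNReal.ofReal (|w j| / ε ^ i) * G 0 (x + (ε * t j) • v)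
  set B : E → ℝ≥0∞ := fun x => ENNReal.ofReal (W / ε ^ i) * (K *
    ∫⁻ u in Icc (-(ε * τ)) (ε * τ), G (m + 1) (x + u • v))
  have hpt : ∀ x ∈ Ω, ‖F i x‖ₑ ≤ (∑ j ∈ J, A j + B) x := by
    intro x hx
    have hmem : ∀ u ∈ Icc (-(ε * τ)) (ε * τ), x + u • v ∈ Ω' := fun u hu =>
      hsub x hx u (abs_le.2 hu)
    have h := enorm_deriv_le_of_nodes J w t hi hw ht hW hε
      (G := fun s u => F s (x + u • v)) (fun s u hu => hd s x u (hmem u hu))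
    simp only [zero_smul, add_zero] at h
    refine h.trans (le_of_eq ?_)
    simp only [Pi.add_apply, Finset.sum_apply, A, B]
    congr 1
    · refine Finset.sum_congr rfl fun j hj => ?_
      rw [hGdef]
      simp only
      rw [indicator_of_mem]
      refine hsub x hx _ ?_
      rw [abs_mul, abs_of_pos hε]
      gcongr
      exact ht j hj
    · congr 2
      refine setLIntegral_congr_fun measurableSet_Icc fun u hu => ?_
      simp only [hGdef]
      rw [indicator_of_mem (hmem u hu)]
  have hAm : ∀ j, Measurable fun x => G 0 (x + (ε * t j) • v) := fun j =>
    (hG 0).comp (measurable_add_const _)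
  have hBm : Measurable fun x => ∫⁻ u in Icc (-(ε * τ)) (ε * τ), G (m + 1) (x + u • v) := by
    refine Measurable.lintegral_prod_right' (f := fun z : E × ℝ => G (m + 1) (z.1 + z.2 • v)) ?_
    refine (hG _).comp ?_
    fun_prop
  have hA : ∀ j ∈ J, eLpNorm (A j) p (μ.restrict Ω) ≤
      ENNReal.ofReal (|w j| / ε ^ i) * eLpNorm (F 0) p (μ.restrict Ω') := by
    intro j hj
    refine (eLpNorm_le_mul_eLpNorm_of_ae_le_mul'' (c := ENNReal.ofReal (|w j| / ε ^ i)) p (hAm j).aestronglyMeasurable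
      (ae_of_all _ fun x => by simp [A])).trans ?_
    gcongr
    rw [← hGF]
    refine eLpNorm_translate_le (hG 0) hΩ.measurableSet hΩ'.measurableSet fun x hx => ?_
    refine hsub x hx _ ?_
    rw [abs_mul, abs_of_pos hε]
    gcongr
    exact ht j hj
  have hB : eLpNorm B p (μ.restrict Ω) ≤ ENNReal.ofReal (W / ε ^ i) *
      (ENNReal.ofReal (2 * (ε * τ) ^ (m + 1) / (m.factorial : ℝ)) *
          eLpNorm (F (m + 1)) p (μ.restrict Ω')) := by
    refine (eLpNorm_le_mul_eLpNorm_of_ae_le_mul'' (c := ENNReal.ofReal (W / ε ^ i) * K) p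
      hBm.aestronglyMeasurable (ae_of_all _ fun x => by simp [B, mul_assoc])).trans ?_
    rw [mul_assoc]
    refine mul_le_mul_right ?_ _
    have h1 : ENNReal.ofReal (2 * (ε * τ) ^ (m + 1) / (m.factorial : ℝ)) =
        K * ENNReal.ofReal (2 * (ε * τ)) := by
      rw [hK, ← ENNReal.ofReal_mul (by positivity)]
      congr 1; ring
    rw [h1, mul_assoc, ← hGF]
    gcongr
    exact eLpNorm_lintegral_translate_le (hG _) hp hΩ.measurableSet hΩ'.measurableSet
      fun x hx u hu => hsub x hx u (abs_le.2 hu)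
  have hAm' : ∀ j ∈ J, AEStronglyMeasurable (A j) (μ.restrict Ω) := fun j _ =>
    ((hAm j).const_mul _).aestronglyMeasurable
  have hBm' : AEStronglyMeasurable B (μ.restrict Ω) :=
    ((hBm.const_mul _).const_mul _).aestronglyMeasurable
  calc eLpNorm (F i) p (μ.restrict Ω) ≤ eLpNorm (∑ j ∈ J, A j + B) p (μ.restrict Ω) :=
        eLpNorm_mono_enorm_ae
          ((ae_restrict_iff' hΩ.measurableSet).2 (ae_of_all _ fun x hx => hpt x hx))
    _ ≤ eLpNorm (∑ j ∈ J, A j) p (μ.restrict Ω) + eLpNorm B p (μ.restrict Ω) :=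
        eLpNorm_add_le (Finset.aestronglyMeasurable_sum _ hAm') hBm' hp
    _ ≤ ∑ j ∈ J, ENNReal.ofReal (|w j| / ε ^ i) * eLpNorm (F 0) p (μ.restrict Ω') +
        ENNReal.ofReal (W / ε ^ i) *
      (ENNReal.ofReal (2 * (ε * τ) ^ (m + 1) / (m.factorial : ℝ)) *
          eLpNorm (F (m + 1)) p (μ.restrict Ω')) := by
        gcongr
        exact (eLpNorm_sum_le hAm' hp).trans (Finset.sum_le_sum hA)
    _ ≤ _ := by
        rw [mul_add, ← Finset.sum_mul,
          ← ENNReal.ofReal_sum_of_nonneg (fun j _ => by positivity), ← Finset.sum_div]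
        gcongr

end Nodes

/-! ### Construction of the differentiation weights. -/

section Weights

/-- The sum is, up to signs of even exponent, the `2 * N`-th forward difference of `x ^ q` at `-N`,
and it annihilates lower degrees. -/
theorem sum_alternating_choose_mul_pow_eq_zero {N q : ℕ} (hq : q < 2 * N) :
    ∑ k ∈ Finset.range (2 * N + 1), (-1 : ℝ) ^ k * ((2 * N).choose k : ℝ) * ((k : ℝ) - N) ^ q = 0 := by
  have h := congrFun (fwdDiff_iter_pow_eq_zero_of_lt (R := ℝ) hq) (-(N : ℝ))
  rw [fwdDiff_iter_eq_sum_shift] at h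
  simp only [Pi.zero_apply] at h
  rw [← h]
  refine Finset.sum_congr rfl fun k hk => ?_
  have hk' : k ≤ 2 * N := Nat.lt_succ_iff.1 (Finset.mem_range.1 hk)
  have h1 : (-1 : ℝ) ^ (2 * N - k) = (-1) ^ k := by
    have h2 : (-1 : ℝ) ^ (2 * N - k) * (-1) ^ k = 1 := by
      rw [← pow_add, Nat.sub_add_cancel hk', pow_mul]; simp
    have h3 : (-1 : ℝ) ^ k * (-1) ^ k = 1 := by
      rw [← mul_pow]; simp
    have h4 : (-1 : ℝ) ^ k ≠ 0 := by positivity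
    exact mul_right_cancel₀ h4 (h2.trans h3.symm)
  rw [zsmul_eq_mul]
  push_cast
  rw [h1]
  congr 2
  simp; ring

theorem sum_inv_sq_le_two (N : ℕ) : ∑ r ∈ Finset.range N, (((r : ℝ) + 1) ^ 2)⁻¹ ≤ 2 := by
  have h : ∀ N : ℕ, ∑ r ∈ Finset.range (N + 1), (((r : ℝ) + 1) ^ 2)⁻¹ ≤ 2 - ((N : ℝ) + 1)⁻¹ := by
    intro N
    induction N with
    | zero => norm_num
    | succ N ih =>
      rw [Finset.sum_range_succ]
      have h1 : ((((N + 1 : ℕ) : ℝ) + 1) ^ 2)⁻¹ ≤ ((N : ℝ) + 1)⁻¹ - (((N + 1 : ℕ) : ℝ) + 1)⁻¹ := by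
        push_cast
        rw [inv_sub_inv (by positivity) (by positivity), inv_eq_one_div]
        rw [div_le_div_iff₀ (by positivity) (by positivity)]
        have : (0 : ℝ) ≤ N := by positivity
        nlinarith
      linarith
  cases N with
  | zero => simp
  | succ N =>
    have : 0 ≤ ((N : ℝ) + 1)⁻¹ := by positivity
    linarith [h N]

theorem sum_inv_sq_centered_le (N : ℕ) :
    ∑ k ∈ Finset.range (2 * N + 1), (((k : ℝ) - N) ^ 2)⁻¹ ≤ 4 := by
  have h2 : 2 * N + 1 = N + (N + 1) := by ring
  rw [h2, Finset.sum_range_add, Finset.sum_range_succ' _ N, ← Finset.sum_range_reflect _ N]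
  have e1 : ∑ j ∈ Finset.range N, ((((N - 1 - j : ℕ) : ℝ) - N) ^ 2)⁻¹ =
      ∑ r ∈ Finset.range N, (((r : ℝ) + 1) ^ 2)⁻¹ := by
    refine Finset.sum_congr rfl fun j hj => ?_
    have hj := Finset.mem_range.1 hj
    rw [Nat.sub_sub, Nat.cast_sub (by omega)]
    push_cast
    congr 1; ring
  have e2 : ∑ j ∈ Finset.range N, ((((N + (j + 1) : ℕ) : ℝ) - N) ^ 2)⁻¹ =
      ∑ r ∈ Finset.range N, (((r : ℝ) + 1) ^ 2)⁻¹ := by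
    refine Finset.sum_congr rfl fun j _ => ?_
    push_cast
    congr 1; ring
  rw [e1, e2]
  simp
  linarith [sum_inv_sq_le_two N]

/-- Nodes in `[-N, N]` and weights of uniformly bounded total mass which evaluate the second
derivative at `0` of polynomials of degree at most `2 * N + 1`. -/
theorem exists_second_derivative_weights {N : ℕ} (hN : 1 ≤ N) : ∃ w : ℕ → ℝ,
    (∑ j ∈ Finset.range (2 * N + 1), |w j| ≤ 16) ∧
    ∀ s ≤ 2 * N + 1, ∑ j ∈ Finset.range (2 * N + 1), w j * ((j : ℝ) - N) ^ s =
      if s = 2 then ((2 : ℕ).factorial : ℝ) else 0 := by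
  -- The central difference normalised by `c N = 1`; then `|c j| ≤ 1`, and `c` is symmetric about
  -- `N`. Dividing by `(j - N) ^ 2` shifts moments by two and makes the mass summable uniformly in
  -- `N`; dividing by `j - N`, for the first derivative, would bring in a logarithm.
  set c : ℕ → ℝ := fun j => (-1 : ℝ) ^ N * ((-1) ^ j * ((2 * N).choose j : ℝ)) / (2 * N).choose N
    with hc
  have hC : (0 : ℝ) < (2 * N).choose N := by exact_mod_cast Nat.choose_pos (by omega)
  have hcsum : ∀ q < 2 * N, ∑ j ∈ Finset.range (2 * N + 1), c j * ((j : ℝ) - N) ^ q = 0 := by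
    intro q hq
    have h := sum_alternating_choose_mul_pow_eq_zero hq
    calc _ = (-1 : ℝ) ^ N / (2 * N).choose N * ∑ k ∈ Finset.range (2 * N + 1),
          (-1 : ℝ) ^ k * ((2 * N).choose k : ℝ) * ((k : ℝ) - N) ^ q := by
          rw [Finset.mul_sum]
          refine Finset.sum_congr rfl fun j _ => ?_
          simp only [hc]; ring
      _ = 0 := by rw [h, mul_zero]
  have hcN : c N = 1 := by
    simp only [hc]
    rw [← mul_assoc, ← mul_pow]
    simp [hC.ne']
  have hc1 : ∀ j, |c j| ≤ 1 := by
    intro j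
    simp only [hc, abs_div, abs_mul, abs_pow, abs_neg, abs_one, one_pow, one_mul, Nat.abs_cast]
    rw [div_le_one hC]
    exact_mod_cast Nat.choose_le_centralBinom j N
  set D : ℝ := ∑ j ∈ Finset.range (2 * N + 1), c j / ((j : ℝ) - N) ^ 2 with hD
  have hDabs : ∑ j ∈ Finset.range (2 * N + 1), |c j / ((j : ℝ) - N) ^ 2| ≤ 4 := by
    refine le_trans (Finset.sum_le_sum fun j _ => ?_) (sum_inv_sq_centered_le N)
    rw [abs_div, abs_of_nonneg (sq_nonneg ((j : ℝ) - N)), div_eq_mul_inv]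
    exact mul_le_of_le_one_left (by positivity) (hc1 j)
  have hmem : N ∈ Finset.range (2 * N + 1) := by simp; omega
  -- At `j = N` the quotient is `0` by convention, so the central term is missing: this produces the
  -- second moment `-2 * (0 - c N) = 2`. The extra central weight `2 * D` corrects the zeroth moment
  -- only. The mass is at most `2 * 4 + 2 * 4`.
  refine ⟨fun j => -2 * (c j / ((j : ℝ) - N) ^ 2) + if j = N then 2 * D else 0, ?_, ?_⟩
  · have h1 : |D| ≤ 4 := (Finset.abs_sum_le_sum_abs _ _).trans hDabs
    calc _ ≤ ∑ j ∈ Finset.range (2 * N + 1), (2 * |c j / ((j : ℝ) - N) ^ 2| +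
          if j = N then 2 * |D| else 0) := by
          refine Finset.sum_le_sum fun j _ => (abs_add_le _ _).trans ?_
          rw [abs_mul]
          split_ifs <;> simp [abs_mul]
      _ ≤ 16 := by
          rw [Finset.sum_add_distrib, ← Finset.mul_sum, Finset.sum_ite_eq', if_pos hmem]
          linarith
  · intro s hs
    have h0 : ∑ j ∈ Finset.range (2 * N + 1), (-2 * (c j / ((j : ℝ) - N) ^ 2) +
        if j = N then 2 * D else 0) * ((j : ℝ) - N) ^ s =
        -2 * ∑ j ∈ Finset.range (2 * N + 1), c j / ((j : ℝ) - N) ^ 2 * ((j : ℝ) - N) ^ s +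
          2 * D * 0 ^ s := by
      simp only [add_mul, ite_mul, zero_mul]
      rw [Finset.sum_add_distrib, Finset.sum_ite_eq', if_pos hmem, sub_self]
      congr 1
      simp only [mul_assoc]
      rw [← Finset.mul_sum]
    rw [h0]
    rcases s with _ | _ | _ | s
    · simp [← hD]
    · have h1 : ∑ j ∈ Finset.range (2 * N + 1), c j / ((j : ℝ) - N) ^ 2 * ((j : ℝ) - N) ^ (0 + 1)
          = 0 := by
        -- The first moment vanishes by the symmetry `j ↦ 2 * N - j`.
        have h2 := Finset.sum_range_reflect
          (fun j : ℕ => c j / ((j : ℝ) - N) ^ 2 * ((j : ℝ) - N) ^ (0 + 1)) (2 * N + 1)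
        have h3 : ∀ j ∈ Finset.range (2 * N + 1),
            c (2 * N + 1 - 1 - j) / (((2 * N + 1 - 1 - j : ℕ) : ℝ) - N) ^ 2 *
              (((2 * N + 1 - 1 - j : ℕ) : ℝ) - N) ^ (0 + 1) =
            -(c j / ((j : ℝ) - N) ^ 2 * ((j : ℝ) - N) ^ (0 + 1)) := by
          intro j hj
          have hj : j ≤ 2 * N := Nat.lt_succ_iff.1 (Finset.mem_range.1 hj)
          have h4 : ((2 * N + 1 - 1 - j : ℕ) : ℝ) - N = -((j : ℝ) - N) := by
            rw [Nat.add_sub_cancel, Nat.cast_sub hj]; push_cast; ring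
          have h5 : c (2 * N + 1 - 1 - j) = c j := by
            simp only [hc, Nat.add_sub_cancel]
            rw [Nat.choose_symm hj]
            congr 3
            have h2 : (-1 : ℝ) ^ (2 * N - j) * (-1) ^ j = 1 := by
              rw [← pow_add, Nat.sub_add_cancel hj, pow_mul]; simp
            have h3 : (-1 : ℝ) ^ j * (-1) ^ j = 1 := by
              rw [← mul_pow]; simp
            have h4 : (-1 : ℝ) ^ j ≠ 0 := by positivity
            exact mul_right_cancel₀ h4 (h2.trans h3.symm)
          rw [h4, h5]; ring
        rw [Finset.sum_congr rfl h3, Finset.sum_neg_distrib] at h2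
        linarith
      rw [h1]; simp
    · have h1 : ∀ j : ℕ, c j / ((j : ℝ) - N) ^ 2 * ((j : ℝ) - N) ^ (0 + 1 + 1) =
          c j * ((j : ℝ) - N) ^ 0 - if j = N then 1 else 0 := by
        intro j
        split_ifs with h
        · subst h; simp [hcN]
        · have : (j : ℝ) - N ≠ 0 := sub_ne_zero.2 (by exact_mod_cast h)
          rw [pow_zero, zero_add, sub_zero, mul_one]; field_simp
      simp only [h1]
      rw [Finset.sum_sub_distrib, hcsum 0 (by omega), Finset.sum_ite_eq', if_pos hmem]
      norm_num
    · have h1 : ∀ j : ℕ, c j / ((j : ℝ) - N) ^ 2 * ((j : ℝ) - N) ^ (s + 1 + 1 + 1) =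
          c j * ((j : ℝ) - N) ^ (s + 1) := by
        intro j
        by_cases h : (j : ℝ) - N = 0
        · simp [h]
        · rw [pow_succ _ (s + 1 + 1), pow_succ _ (s + 1)]; field_simp
      simp only [h1]
      rw [hcsum (s + 1) (by omega)]
      simp

open Polynomial in
-- The right side is the value at `R` of `∏ (X + |r a|)`, whose coefficients dominate those of the
-- given product in absolute value.
theorem abs_coeff_prod_X_sub_C_mul_pow_le {ι : Type*} (A : Finset ι) (r : ι → ℝ) {R : ℝ}
    (hR : 0 ≤ R) (i : ℕ) :
    |(∏ a ∈ A, (X - C (r a))).coeff i| * R ^ i ≤ ∏ a ∈ A, (R + |r a|) := by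
  classical
  induction A using Finset.induction_on generalizing i with
  | empty =>
    simp only [Finset.prod_empty, coeff_one]
    split_ifs with h
    · simp [h]
    · simp
  | insert a A ha ih =>
    rw [Finset.prod_insert ha, Finset.prod_insert ha, sub_mul, coeff_sub, coeff_C_mul, add_mul]
    set Q := ∏ a ∈ A, (X - C (r a))
    have h2 : |r a * Q.coeff i| * R ^ i ≤ |r a| * ∏ a ∈ A, (R + |r a|) := by
      rw [abs_mul, mul_assoc]
      gcongr
      exact ih i
    have h1 : |(X * Q).coeff i| * R ^ i ≤ R * ∏ a ∈ A, (R + |r a|) := by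
      cases i with
      | zero =>
        simp
        exact mul_nonneg hR (Finset.prod_nonneg fun a _ => by positivity)
      | succ i =>
        rw [coeff_X_mul, pow_succ, ← mul_assoc, mul_comm]
        gcongr
        exact ih i
    calc _ ≤ (|(X * Q).coeff i| + |r a * Q.coeff i|) * R ^ i := by
          gcongr; exact abs_sub _ _
      _ ≤ _ := by rw [add_mul]; linarith

/-- These are the denominators of the Lagrange basis at the nodes `0, …, m`. -/
theorem abs_prod_range_erase_sub {m j : ℕ} (hj : j ≤ m) :
    |∏ r ∈ (Finset.range (m + 1)).erase j, ((j : ℝ) - r)| =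
      (j.factorial : ℝ) * ((m - j).factorial : ℝ) := by
  obtain ⟨b, rfl⟩ := Nat.exists_eq_add_of_le hj
  have h1 : (Finset.range (j + b + 1)).erase j =
      Finset.range j ∪ (Finset.range b).image fun r => j + 1 + r := by
    ext r
    simp only [Finset.mem_erase, Finset.mem_range, Finset.mem_union, Finset.mem_image]
    constructor
    · rintro ⟨h1, h2⟩
      rcases lt_or_gt_of_ne h1 with h | h
      · exact Or.inl h
      · exact Or.inr ⟨r - (j + 1), by omega, by omega⟩
    · rintro (h | ⟨a, h, rfl⟩) <;> omega
  rw [h1, Finset.prod_union, Finset.prod_image (fun a _ b _ h => by simpa using h), abs_mul,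
    Finset.abs_prod, Finset.abs_prod]
  · congr 1
    · rw [← Finset.prod_range_reflect, ← Finset.prod_range_add_one_eq_factorial]
      push_cast
      refine Finset.prod_congr rfl fun r hr => ?_
      have hr := Finset.mem_range.1 hr
      rw [Nat.sub_sub, Nat.cast_sub (by omega)]
      push_cast
      rw [abs_of_nonneg (by have : (0 : ℝ) ≤ r := by positivity
                            linarith)]
      ring
    · rw [Nat.add_sub_cancel_left, ← Finset.prod_range_add_one_eq_factorial]
      push_cast
      refine Finset.prod_congr rfl fun r _ => ?_
      rw [abs_of_nonpos (by have : (0 : ℝ) ≤ r := by positivity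
                            linarith)]
      ring
  · rw [Finset.disjoint_left]
    intro a ha hb
    obtain ⟨c, _, rfl⟩ := Finset.mem_image.1 hb
    have := Finset.mem_range.1 ha
    omega

theorem pow_self_div_factorial_le (m : ℕ) : (m : ℝ) ^ m / (m.factorial : ℝ) ≤ 3 ^ m := by
  refine (Real.pow_div_factorial_le_exp _ (Nat.cast_nonneg m) m).trans ?_
  rw [← mul_one (m : ℝ), Real.exp_nat_mul]
  gcongr
  exact Real.exp_one_lt_three.le

open Polynomial in
/-- Weights at the nodes `0, …, m`, of total mass at most `12 ^ m`, which evaluate the `i`-th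
derivative at `0` of polynomials of degree at most `m`. -/
theorem exists_derivative_weights {m i : ℕ} (hi : i ≤ m) : ∃ w : ℕ → ℝ,
    (∑ j ∈ Finset.range (m + 1), |w j| ≤ 12 ^ m) ∧
    ∀ s ≤ m, ∑ j ∈ Finset.range (m + 1), w j * (j : ℝ) ^ s =
      if s = i then (i.factorial : ℝ) else 0 := by
  set J := Finset.range (m + 1)
  set q : ℕ → ℝ := fun j => ∏ r ∈ J.erase j, ((j : ℝ) - r)
  set Q : ℕ → ℝ[X] := fun j => ∏ r ∈ J.erase j, (X - C (r : ℝ))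
  -- The `i`-th derivative at `0` of the Lagrange basis polynomial `Q j / q j`; exactness is
  -- interpolation of `X ^ s`.
  refine ⟨fun j => (i.factorial : ℝ) * ((Q j).coeff i / q j), ?_, ?_⟩
  · have h1 : ∀ j ∈ J, |(i.factorial : ℝ) * ((Q j).coeff i / q j)| ≤
        (2 * (m : ℝ)) ^ m / (m.factorial : ℝ) * (m.choose j : ℝ) := by
      intro j hj
      have hj' : j ≤ m := Nat.lt_succ_iff.1 (Finset.mem_range.1 hj)
      have h2 : (i.factorial : ℝ) * |(Q j).coeff i| ≤ (2 * (m : ℝ)) ^ m := by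
        calc (i.factorial : ℝ) * |(Q j).coeff i| ≤ (m : ℝ) ^ i * |(Q j).coeff i| := by
              gcongr
              calc (i.factorial : ℝ) ≤ (i : ℝ) ^ i := by exact_mod_cast Nat.factorial_le_pow i
                _ ≤ (m : ℝ) ^ i := by gcongr
          _ = |(Q j).coeff i| * (m : ℝ) ^ i := mul_comm _ _
          _ ≤ ∏ r ∈ J.erase j, ((m : ℝ) + |(r : ℝ)|) :=
              abs_coeff_prod_X_sub_C_mul_pow_le _ _ (by positivity) i
          _ ≤ ∏ _r ∈ J.erase j, (2 * (m : ℝ)) := by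
              refine Finset.prod_le_prod (fun _ _ => by positivity) fun r hr => ?_
              have : r ≤ m := Nat.lt_succ_iff.1 (Finset.mem_range.1 (Finset.mem_of_mem_erase hr))
              have : (r : ℝ) ≤ m := by exact_mod_cast this
              rw [Nat.abs_cast]; linarith
          _ = (2 * (m : ℝ)) ^ m := by
              rw [Finset.prod_const, Finset.card_erase_of_mem hj, Finset.card_range,
                Nat.add_sub_cancel]
      rw [abs_mul, abs_div, Nat.abs_cast, ← mul_div_assoc, abs_prod_range_erase_sub hj']
      have h3 : ((m.choose j : ℝ)) * ((j.factorial : ℝ) * ((m - j).factorial : ℝ)) =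
          (m.factorial : ℝ) := by
        rw [← mul_assoc]; exact_mod_cast Nat.choose_mul_factorial_mul_factorial hj'
      rw [div_mul_eq_mul_div, div_le_div_iff₀ (by positivity) (by positivity), ← h3]
      have : 0 ≤ ((m.choose j : ℝ)) * ((j.factorial : ℝ) * ((m - j).factorial : ℝ)) := by
        positivity
      nlinarith
    refine (Finset.sum_le_sum h1).trans ?_
    rw [← Finset.mul_sum]
    have h2 : ∑ j ∈ J, (m.choose j : ℝ) = 2 ^ m := by exact_mod_cast Nat.sum_range_choose m
    rw [h2]
    calc (2 * (m : ℝ)) ^ m / (m.factorial : ℝ) * 2 ^ m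
        = 4 ^ m * ((m : ℝ) ^ m / (m.factorial : ℝ)) := by
          rw [mul_pow, show (4 : ℝ) = 2 * 2 by norm_num, mul_pow]; ring
      _ ≤ 4 ^ m * 3 ^ m := by gcongr; exact pow_self_div_factorial_le m
      _ = 12 ^ m := by rw [← mul_pow]; norm_num
  · intro s hs
    have h := Lagrange.eq_interpolate (s := J) (v := fun j : ℕ => (j : ℝ)) (f := (X : ℝ[X]) ^ s)
      (fun a _ b _ h => Nat.cast_injective h)
      (by rw [degree_X_pow, Finset.card_range]; exact_mod_cast Nat.lt_succ_of_le hs)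
    rw [Lagrange.interpolate_eq_sum] at h
    have h1 := congrArg (fun P : ℝ[X] => P.coeff i) h
    simp only [coeff_X_pow, finsetSum_coeff, coeff_C_mul, eval_pow, eval_X] at h1
    calc _ = (i.factorial : ℝ) * ∑ j ∈ J, (j : ℝ) ^ s / q j * (Q j).coeff i := by
          rw [Finset.mul_sum]
          refine Finset.sum_congr rfl fun j _ => ?_
          ring
      _ = _ := by
          rw [← h1]
          simp [eq_comm]

end Weights

/-! ### Interpolation inequalities between orders `0` and `M`. -/

section Interpolation

theorem ENNReal.le_ofReal_mul_of_le {x y z q : ℝ≥0∞} {a b c d : ℝ} (ha : 0 ≤ a) (hb : 0 ≤ b)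
    (hc : 0 ≤ c) (h : x ≤ ENNReal.ofReal a * (z + ENNReal.ofReal b * y)) (hz : z ≤ q)
    (hy : y ≤ ENNReal.ofReal c * q) (hd : a * (1 + b * c) ≤ d) : x ≤ ENNReal.ofReal d * q := by
  calc x ≤ ENNReal.ofReal a * (z + ENNReal.ofReal b * y) := h
    _ ≤ ENNReal.ofReal a * (q + ENNReal.ofReal b * (ENNReal.ofReal c * q)) := by gcongr
    _ = ENNReal.ofReal (a * (1 + b * c)) * q := by
      rw [ENNReal.ofReal_mul ha, ENNReal.ofReal_add zero_le_one (by positivity),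
        ENNReal.ofReal_mul hb, ENNReal.ofReal_one]
      ring
    _ ≤ ENNReal.ofReal d * q := by gcongr

theorem natCast_le_two_pow (m : ℕ) : (m : ℝ) ≤ 2 ^ m := by
  exact_mod_cast (Nat.lt_two_pow_self (n := m)).le

theorem natCast_pow_succ_div_factorial_le (m : ℕ) :
    (m : ℝ) ^ (m + 1) / (m.factorial : ℝ) ≤ 6 ^ m := by
  calc (m : ℝ) ^ (m + 1) / (m.factorial : ℝ) = m * ((m : ℝ) ^ m / (m.factorial : ℝ)) := by
        rw [pow_succ]; ring
    _ ≤ 2 ^ m * 3 ^ m := by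
        gcongr
        · exact natCast_le_two_pow m
        · exact pow_self_div_factorial_le m
    _ = 6 ^ m := by rw [← mul_pow]; norm_num

variable {𝕜 : Type*} [RCLike 𝕜]
  {E : Type*} [NormedAddCommGroup E] [NormedSpace ℝ E] [MeasurableSpace E] [BorelSpace E]
  [SecondCountableTopology E] {μ : Measure E} [SigmaFinite μ] [μ.IsAddHaarMeasure]
  {p : ℝ≥0∞} {v : E} {F : ℕ → E → 𝕜} {q : ℝ≥0∞} {T : ℝ}

/-- With step `1 / (12 * T)` the remainder factor is at most `1`, because `m ^ (m + 1) / m! ≤ 6 ^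
m`. The constant is `4608 = 2 * 16 * 12 ^ 2`, independent of `M`. -/
theorem eLpNorm_second_deriv_le (hp : 1 ≤ p) (hF : ∀ s, Continuous (F s))
    (hd : ∀ s x, ∀ u : ℝ,
      HasDerivAt (fun u : ℝ => F s (x + u • v)) (F (s + 1) (x + u • v)) u)
    {M : ℕ} (hM : 2 ≤ M) (hT : 0 < T) (h0 : eLpNorm (F 0) p μ ≤ q)
    (h1 : eLpNorm (F M) p μ ≤ ENNReal.ofReal (T ^ M) * q) :
    eLpNorm (F 2) p μ ≤ ENNReal.ofReal (4608 * T ^ 2) * q := by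
  rcases hM.eq_or_lt with rfl | hM
  · refine h1.trans ?_
    gcongr
    nlinarith [sq_nonneg T]
  obtain ⟨m, rfl⟩ : ∃ m, M = m + 1 := ⟨M - 1, by omega⟩
  obtain ⟨w, hW, hw⟩ := exists_second_derivative_weights (N := m) (by omega)
  have key := eLpNorm_deriv_le_of_nodes (μ := μ) (ε := 1 / (12 * T)) (τ := m) (W := 16) (v := v)
    (F := F) (Ω := univ) (Ω' := univ) (p := p) (Finset.range (2 * m + 1)) w (fun j => (j : ℝ) - m)
    (i := 2) (m := m) (by omega) (fun s hs => hw s (by omega)) (fun j hj => by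
      have hj : j ≤ 2 * m := Nat.lt_succ_iff.1 (Finset.mem_range.1 hj)
      have hj : (j : ℝ) ≤ 2 * m := by exact_mod_cast hj
      have : (0 : ℝ) ≤ j := by positivity
      rw [abs_le]; constructor <;> linarith) hW (by positivity) (by positivity) hp isOpen_univ
      isOpen_univ (fun s => (hF s).continuousOn) (fun s x u _ => hd s x u)
      (fun _ _ _ _ => mem_univ _)
  simp only [Measure.restrict_univ] at key
  refine ENNReal.le_ofReal_mul_of_le (by positivity) (by positivity) (by positivity) key h0 h1 ?_
  have h2 : 2 * (1 / (12 * T) * (m : ℝ)) ^ (m + 1) / (m.factorial : ℝ) * T ^ (m + 1) ≤ 1 := by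
    calc _ = 2 * (1 / 12) ^ (m + 1) * ((m : ℝ) ^ (m + 1) / (m.factorial : ℝ)) := by
          rw [one_div_mul_eq_div, div_pow, mul_pow, one_div, inv_pow]; field_simp
      _ ≤ 2 * (1 / 12) ^ (m + 1) * 6 ^ m := by
          gcongr; exact natCast_pow_succ_div_factorial_le m
      _ = 1 / 6 * (1 / 2) ^ m := by
          rw [pow_succ, show (1 / 2 : ℝ) = 1 / 12 * 6 by norm_num, mul_pow]; ring
      _ ≤ 1 / 6 * 1 := by
          gcongr; exact pow_le_one₀ (by norm_num) (by norm_num)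
      _ ≤ 1 := by norm_num
  have h3 : 16 / (1 / (12 * T)) ^ 2 = 2304 * T ^ 2 := by
    field_simp; norm_num
  rw [h3]
  nlinarith [sq_nonneg T]

/-- A Landau–Kolmogorov type inequality in additive form, with a constant which does not depend on
the order. -/
theorem eLpNorm_first_deriv_le (hp : 1 ≤ p) (hF : ∀ s, Continuous (F s))
    (hd : ∀ s x, ∀ u : ℝ,
      HasDerivAt (fun u : ℝ => F s (x + u • v)) (F (s + 1) (x + u • v)) u)
    {M : ℕ} (hM : 1 ≤ M) (hT : 0 < T) (h0 : eLpNorm (F 0) p μ ≤ q)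
    (h1 : eLpNorm (F M) p μ ≤ ENNReal.ofReal (T ^ M) * q) :
    eLpNorm (F 1) p μ ≤ ENNReal.ofReal (20000 * T) * q := by
  rcases hM.eq_or_lt with rfl | hM
  · refine h1.trans ?_
    gcongr
    rw [pow_one]; linarith
  have h2 := eLpNorm_second_deriv_le hp hF hd hM hT h0 h1
  -- A plain forward difference with step `1 / T`, whose remainder involves the second derivative
  -- just bounded: `2 * (1 + 2 * 4608) = 18434`.
  have key := eLpNorm_deriv_le_of_nodes (μ := μ) (ε := 1 / T) (τ := 1) (W := 2) (v := v)
    (F := F) (Ω := univ) (Ω' := univ) (p := p) (Finset.range 2) (fun j => if j = 0 then -1 else 1)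
    (fun j => (j : ℝ)) (i := 1) (m := 1) le_rfl (fun s hs => by
      interval_cases s <;> simp [Finset.sum_range_succ]) (fun j hj => by
      have hj := Finset.mem_range.1 hj
      interval_cases j <;> simp) (by simp [Finset.sum_range_succ]; norm_num)
      (by positivity) (by positivity) hp isOpen_univ
      isOpen_univ (fun s => (hF s).continuousOn) (fun s x u _ => hd s x u)
      (fun _ _ _ _ => mem_univ _)
  simp only [Measure.restrict_univ] at key
  refine ENNReal.le_ofReal_mul_of_le (by positivity) (by positivity) (by positivity) key h0 h2 ?_
  have h3 : 2 / (1 / T) ^ 1 * (1 + 2 * (1 / T * 1) ^ (1 + 1) / ((1 : ℕ).factorial : ℝ) *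
      (4608 * T ^ 2)) = 18434 * T := by
    simp
    field_simp
    norm_num
  rw [h3]
  linarith

/-- All orders `i` are reached in one application, so the domain shrinks once, by at most `M / T`.
The price is `72 ^ M`, with `72 = 12 * 6` from the mass of the weights and the remainder. -/
theorem eLpNorm_local_deriv_le (hp : 1 ≤ p) {Ω Ω' : Set E} (hΩ : IsOpen Ω)
    (hΩ' : IsOpen Ω') (hF : ∀ s, ContinuousOn (F s) Ω')
    (hd : ∀ s x, ∀ u : ℝ, x + u • v ∈ Ω' →
      HasDerivAt (fun u : ℝ => F s (x + u • v)) (F (s + 1) (x + u • v)) u)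
    {M i : ℕ} (hi : i ≤ M) (hT : 0 < T)
    (hsub : ∀ x ∈ Ω, ∀ u : ℝ, |u| ≤ M / T → x + u • v ∈ Ω')
    (h0 : eLpNorm (F 0) p (μ.restrict Ω') ≤ q)
    (h1 : eLpNorm (F M) p (μ.restrict Ω') ≤ ENNReal.ofReal (T ^ M) * q) :
    eLpNorm (F i) p (μ.restrict Ω) ≤ ENNReal.ofReal (72 ^ M * T ^ i) * q := by
  rcases hi.eq_or_lt with rfl | hi
  · have hsub' : Ω ⊆ Ω' := fun x hx => by
      simpa using hsub x hx 0 (by simp only [abs_zero]; positivity)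
    refine ((eLpNorm_mono_measure _ (Measure.restrict_mono hsub' le_rfl)).trans h1).trans ?_
    gcongr
    exact le_mul_of_one_le_left (by positivity) (one_le_pow₀ (by norm_num))
  obtain ⟨m, rfl⟩ : ∃ m, M = m + 1 := ⟨M - 1, by omega⟩
  have him : i ≤ m := Nat.lt_succ_iff.1 hi
  obtain ⟨w, hW, hw⟩ := exists_derivative_weights him
  have key := eLpNorm_deriv_le_of_nodes (μ := μ) (ε := 1 / T) (τ := m) (W := 12 ^ m) (v := v)
    (F := F) (p := p) (Finset.range (m + 1)) w (fun j => (j : ℝ)) him hw (fun j hj => by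
      have hj : j ≤ m := Nat.lt_succ_iff.1 (Finset.mem_range.1 hj)
      rw [Nat.abs_cast]
      exact_mod_cast hj) hW (by positivity) (by positivity) hp hΩ hΩ' hF hd
      (fun x hx u hu => hsub x hx u (hu.trans (by
        rw [one_div_mul_eq_div]; gcongr; linarith)))
  refine ENNReal.le_ofReal_mul_of_le (by positivity) (by positivity) (by positivity) key h0 h1 ?_
  have h2 : 2 * (1 / T * (m : ℝ)) ^ (m + 1) / (m.factorial : ℝ) * T ^ (m + 1) ≤ 2 * 6 ^ m := by
    calc _ = 2 * ((m : ℝ) ^ (m + 1) / (m.factorial : ℝ)) := by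
          rw [one_div_mul_eq_div, div_pow]; field_simp
      _ ≤ _ := by gcongr; exact natCast_pow_succ_div_factorial_le m
  have h3 : (12 : ℝ) ^ m / (1 / T) ^ i = 12 ^ m * T ^ i := by
    rw [one_div, inv_pow, div_inv_eq_mul]
  rw [h3]
  have h6 : (1 : ℝ) ≤ 6 ^ m := one_le_pow₀ (by norm_num)
  calc 12 ^ m * T ^ i * (1 + 2 * (1 / T * (m : ℝ)) ^ (m + 1) / (m.factorial : ℝ) * T ^ (m + 1))
      ≤ 12 ^ m * T ^ i * (72 * 6 ^ m) := by gcongr; linarith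
    _ = 72 ^ (m + 1) * T ^ i := by
      rw [pow_succ, show (72 : ℝ) ^ m = 12 ^ m * 6 ^ m by rw [← mul_pow]; norm_num]; ring

end Interpolation

/-! ### Interpolation for mixed partial derivatives. -/

section MultiIndex

variable {𝕜 : Type*} [RCLike 𝕜] {n : ℕ}

theorem multiOrder_add (α β : Fin n → ℕ) :
    multiOrder (α + β) = multiOrder α + multiOrder β := Finset.sum_add_distrib

theorem multiOrder_single (i : Fin n) (c : ℕ) : multiOrder (Pi.single i c) = c := by
  simp [multiOrder]

theorem exists_eq_add_single {α : Fin n → ℕ} {a : ℕ} (h : multiOrder α = a + 1) :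
    ∃ (β : Fin n → ℕ) (i : Fin n), α = β + Pi.single i 1 ∧ multiOrder β = a := by
  obtain ⟨i, -, hi⟩ : ∃ i ∈ Finset.univ, α i ≠ 0 := by
    by_contra! hc
    have : multiOrder α = 0 := Finset.sum_eq_zero hc
    omega
  have h1 : α = (α - Pi.single i 1) + Pi.single i 1 := by
    ext j
    by_cases hj : j = i
    · subst hj
      simp; omega
    · simp [hj]
  refine ⟨_, i, h1, ?_⟩
  have h2 := congrArg multiOrder h1
  rw [multiOrder_add, multiOrder_single, h] at h2
  omega

theorem exists_eq_add_of_multiOrder (i : ℕ) {α : Fin n → ℕ} {a : ℕ} (h : multiOrder α = a + i) :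
    ∃ β γ : Fin n → ℕ, α = β + γ ∧ multiOrder β = a ∧ multiOrder γ = i := by
  induction i generalizing α with
  | zero => exact ⟨α, 0, by simp, h, by simp [multiOrder]⟩
  | succ i ih =>
    obtain ⟨α', r, rfl, h'⟩ := exists_eq_add_single (a := a + i) h
    obtain ⟨β, γ, rfl, hβ, hγ⟩ := ih h'
    exact ⟨β, γ + Pi.single r 1, by rw [add_assoc], hβ, by
      rw [multiOrder_add, multiOrder_single, hγ]⟩

theorem hasDerivAt_multiDeriv_add_single {f : EuclideanSpace ℝ (Fin n) → 𝕜}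
    {U : Set (EuclideanSpace ℝ (Fin n))} (hU : IsOpen U) (hf : ContDiffOn ℝ ∞ f U)
    (α : Fin n → ℕ) (i : Fin n) (s : ℕ) (x : EuclideanSpace ℝ (Fin n)) (u : ℝ)
    (hx : x + u • EuclideanSpace.single i (1 : ℝ) ∈ U) :
    HasDerivAt (fun u : ℝ => multiDeriv (α + Pi.single i s) f
        (x + u • EuclideanSpace.single i (1 : ℝ)))
      (multiDeriv (α + Pi.single i (s + 1)) f (x + u • EuclideanSpace.single i (1 : ℝ))) u := by
  have := hasDerivAt_multiDeriv hU hf (α + Pi.single i s) i x u hx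
  rwa [add_assoc, ← Pi.single_add] at this

theorem eLpNorm_multiDeriv_le_of_global {f : EuclideanSpace ℝ (Fin n) → 𝕜} (hf : ContDiff ℝ ∞ f)
    {p : ℝ≥0∞} (hp : 1 ≤ p) {a M : ℕ} {T : ℝ} (hT : 0 < T) {q : ℝ≥0∞}
    (h0 : ∀ α : Fin n → ℕ, multiOrder α = a →
      eLpNorm (multiDeriv α f) p volume ≤ ENNReal.ofReal (T ^ a) * q)
    (h1 : ∀ α : Fin n → ℕ, multiOrder α = a + M →
      eLpNorm (multiDeriv α f) p volume ≤ ENNReal.ofReal (T ^ (a + M)) * q)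
    {i : ℕ} (hi : i ≤ M) {α : Fin n → ℕ} (hα : multiOrder α = a + i) :
    eLpNorm (multiDeriv α f) p volume ≤ ENNReal.ofReal (20000 ^ i * T ^ (a + i)) * q := by
  induction i generalizing α with
  | zero => simpa using h0 α hα
  | succ i ih =>
    obtain ⟨β, r, rfl, hβ⟩ := exists_eq_add_single (a := a + i) hα
    have hfU : ContDiffOn ℝ ∞ f univ := hf.contDiffOn
    have hder : ∀ (s : ℕ) (x : EuclideanSpace ℝ (Fin n)) (u : ℝ),
        HasDerivAt (fun u : ℝ => multiDeriv (β + Pi.single r s) f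
          (x + u • EuclideanSpace.single r (1 : ℝ)))
        (multiDeriv (β + Pi.single r (s + 1)) f (x + u • EuclideanSpace.single r (1 : ℝ))) u :=
      fun s x u => hasDerivAt_multiDeriv_add_single isOpen_univ hfU β r s x u (mem_univ _)
    have h20 : (1 : ℝ) ≤ 20000 ^ i := one_le_pow₀ (by norm_num)
    have key := eLpNorm_first_deriv_le (μ := volume) (T := T) (M := M - i) hp
      (F := fun s => multiDeriv (β + Pi.single r s) f)
      -- The bound already reached at order `a + i` is the new lower end; the upper end stays at `a
      -- + M`, so the gap is now `M - i`.
      (q := ENNReal.ofReal (20000 ^ i * T ^ (a + i)) * q)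
      (fun s => continuousOn_univ.1 (hfU.multiDeriv isOpen_univ _).continuousOn)
      hder
      (by omega) hT (by simpa using ih (by omega) hβ) (by
        refine (h1 _ (by rw [multiOrder_add, multiOrder_single]; omega)).trans ?_
        rw [← mul_assoc, ← ENNReal.ofReal_mul (by positivity)]
        gcongr
        rw [show a + M = (M - i) + (a + i) by omega, pow_add]
        gcongr
        exact le_mul_of_one_le_left (pow_nonneg hT.le _) h20)
    refine key.trans (le_of_eq ?_)
    rw [← mul_assoc, ← ENNReal.ofReal_mul (by positivity)]
    congr 2
    ring

/-- Induction on the set `S` of directions allowed in `γ`: each direction costs a thickening by `δ`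
and a factor `72 ^ M`. The `+ 1` in the radius keeps it positive when `S` is empty. -/
theorem eLpNorm_multiDeriv_le_of_local_aux {f : EuclideanSpace ℝ (Fin n) → 𝕜}
    {U V : Set (EuclideanSpace ℝ (Fin n))} (hU : IsOpen U) (hf : ContDiffOn ℝ ∞ f U) (hVU : V ⊆ U)
    {p : ℝ≥0∞} (hp : 1 ≤ p) {a M : ℕ} {T δ : ℝ} (hT : 0 < T) (hδ : M / T < δ) {q : ℝ≥0∞}
    (h0 : ∀ α : Fin n → ℕ, multiOrder α = a →
      eLpNorm (multiDeriv α f) p (volume.restrict V) ≤ ENNReal.ofReal (T ^ a) * q)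
    (h1 : ∀ α : Fin n → ℕ, multiOrder α = a + M →
      eLpNorm (multiDeriv α f) p (volume.restrict V) ≤ ENNReal.ofReal (T ^ (a + M)) * q)
    (S : Finset (Fin n)) {Ω : Set (EuclideanSpace ℝ (Fin n))} (hΩ : IsOpen Ω)
    (hΩV : Metric.thickening ((S.card + 1) * δ) Ω ⊆ V)
    {β γ : Fin n → ℕ} (hβ : multiOrder β = a) (hγS : ∀ i ∉ S, γ i = 0) (hγ : multiOrder γ ≤ M) :
    eLpNorm (multiDeriv (β + γ) f) p (volume.restrict Ω) ≤
      ENNReal.ofReal (72 ^ (M * S.card) * T ^ (a + multiOrder γ)) * q := by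
  have hδ0 : 0 < δ := lt_of_le_of_lt (by positivity) hδ
  induction S using Finset.induction_on generalizing Ω γ with
  | empty =>
    have : γ = 0 := funext fun i => hγS i (by simp)
    subst this
    have hsub : Ω ⊆ V := (Metric.self_subset_thickening (by positivity) _).trans hΩV
    refine (eLpNorm_mono_measure _ (Measure.restrict_mono hsub le_rfl)).trans ?_
    simpa [multiOrder] using h0 β hβ
  | insert r S hr ih =>
    set γ' : Fin n → ℕ := Function.update γ r 0 with hγ'
    have hsplit : γ = γ' + Pi.single r (γ r) := by
      ext j
      by_cases hj : j = r
      · subst hj; simp [hγ']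
      · simp [hγ', hj]
    have hord : multiOrder γ = multiOrder γ' + γ r := by
      conv_lhs => rw [hsplit]
      rw [multiOrder_add, multiOrder_single]
    rw [Finset.card_insert_of_notMem hr] at hΩV ⊢
    set Ω₁ := Metric.thickening δ Ω with hΩ₁
    have hsub₁ : Metric.thickening ((S.card + 1) * δ) Ω₁ ⊆ V := by
      refine (Metric.thickening_thickening_subset _ _ _).trans (Eq.trans_subset ?_ hΩV)
      congr 1; push_cast; ring
    have hδS : 0 < (S.card + 1) * δ := mul_pos (Nat.cast_add_one_pos _) hδ0
    have hΩ₁V : Ω₁ ⊆ V := (Metric.self_subset_thickening hδS _).trans hsub₁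
    have hder : ∀ (s : ℕ) (x : EuclideanSpace ℝ (Fin n)) (u : ℝ),
        x + u • EuclideanSpace.single r (1 : ℝ) ∈ Ω₁ →
        HasDerivAt (fun u : ℝ => multiDeriv (β + γ' + Pi.single r s) f
          (x + u • EuclideanSpace.single r (1 : ℝ)))
        (multiDeriv (β + γ' + Pi.single r (s + 1)) f (x + u • EuclideanSpace.single r (1 : ℝ))) u :=
      fun s x u hx => hasDerivAt_multiDeriv_add_single hU hf _ r s x u (hVU (hΩ₁V hx))
    have ih' := ih Metric.isOpen_thickening hsub₁ (γ := γ') (fun i hi => by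
      by_cases hir : i = r
      · subst hir; simp [hγ']
      · simp only [hγ', Function.update_of_ne hir]
        exact hγS i (by simp [hi, hir])) (by omega)
    have h72 : (1 : ℝ) ≤ 72 ^ (M * S.card) := one_le_pow₀ (by norm_num)
    have key := eLpNorm_local_deriv_le (μ := volume) (T := T) (M := M - multiOrder γ') (i := γ r) hp
      (v := EuclideanSpace.single r (1 : ℝ))
      (F := fun s => multiDeriv (β + γ' + Pi.single r s) f) hΩ Metric.isOpen_thickening
      (q := ENNReal.ofReal (72 ^ (M * S.card) * T ^ (a + multiOrder γ')) * q) (Ω' := Ω₁)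
      (fun s => (hf.multiDeriv hU _).continuousOn.mono (hΩ₁V.trans hVU))
      hder
      (by omega) hT (fun x hx u hu => by
        refine Metric.mem_thickening_iff.2 ⟨x, hx, ?_⟩
        rw [dist_eq_norm, add_sub_cancel_left, norm_smul, PiLp.norm_single]
        simp only [norm_one, mul_one, Real.norm_eq_abs]
        refine (hu.trans ?_).trans_lt hδ
        gcongr
        exact Nat.sub_le _ _)
      (by simpa only [Pi.single_zero, add_zero] using ih') (by
        refine (eLpNorm_mono_measure _ (Measure.restrict_mono hΩ₁V le_rfl)).trans ?_
        refine (h1 _ (by rw [multiOrder_add, multiOrder_add, multiOrder_single]; omega)).trans ?_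
        rw [← mul_assoc, ← ENNReal.ofReal_mul (by positivity)]
        gcongr
        rw [show a + M = (M - multiOrder γ') + (a + multiOrder γ') by omega, pow_add]
        gcongr
        exact le_mul_of_one_le_left (pow_nonneg hT.le _) h72)
    have hidx : β + γ = β + γ' + Pi.single r (γ r) := by rw [add_assoc, ← hsplit]
    rw [hidx]
    refine key.trans ?_
    rw [← mul_assoc, ← ENNReal.ofReal_mul (by positivity), hord]
    gcongr ENNReal.ofReal ?_ * q
    calc (72 : ℝ) ^ (M - multiOrder γ') * T ^ γ r * (72 ^ (M * S.card) * T ^ (a + multiOrder γ'))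
        ≤ 72 ^ M * T ^ γ r * (72 ^ (M * S.card) * T ^ (a + multiOrder γ')) := by
          gcongr
          · norm_num
          · exact Nat.sub_le _ _
      _ = _ := by ring

theorem eLpNorm_multiDeriv_le_of_local {f : EuclideanSpace ℝ (Fin n) → 𝕜}
    {U V : Set (EuclideanSpace ℝ (Fin n))} (hU : IsOpen U) (hf : ContDiffOn ℝ ∞ f U) (hVU : V ⊆ U)
    {p : ℝ≥0∞} (hp : 1 ≤ p) {a M : ℕ} {T δ : ℝ} (hT : 0 < T) (hδ : M / T < δ) {q : ℝ≥0∞}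
    (h0 : ∀ α : Fin n → ℕ, multiOrder α = a →
      eLpNorm (multiDeriv α f) p (volume.restrict V) ≤ ENNReal.ofReal (T ^ a) * q)
    (h1 : ∀ α : Fin n → ℕ, multiOrder α = a + M →
      eLpNorm (multiDeriv α f) p (volume.restrict V) ≤ ENNReal.ofReal (T ^ (a + M)) * q)
    {Ω : Set (EuclideanSpace ℝ (Fin n))} (hΩ : IsOpen Ω)
    (hΩV : Metric.thickening ((n + 1) * δ) Ω ⊆ V)
    {i : ℕ} (hi : i ≤ M) {α : Fin n → ℕ} (hα : multiOrder α = a + i) :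
    eLpNorm (multiDeriv α f) p (volume.restrict Ω) ≤
      ENNReal.ofReal (72 ^ (M * n) * T ^ (a + i)) * q := by
  obtain ⟨β, γ, rfl, hβ, rfl⟩ := exists_eq_add_of_multiOrder i hα
  simpa using eLpNorm_multiDeriv_le_of_local_aux hU hf hVU hp hT hδ h0 h1 Finset.univ hΩ
    (by simpa using hΩV) hβ (by simp) hi

end MultiIndex

/-! ### Elementary properties of weight and base sequences. -/

section WeightSequences

theorem rootSeq_zero (M : ℕ → ℝ) : rootSeq M 0 = 1 := by simp [rootSeq]

theorem IsWeightSeq.rootSeq_pos {M : ℕ → ℝ} (hM : IsWeightSeq M) (j : ℕ) : 0 < rootSeq M j :=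
  Real.rpow_pos_of_pos (hM.pos j) _

/-- `M j` is the product of the first `j` quotients, none of which exceeds the next one. -/
theorem IsWeightSeq.le_quot_pow {M : ℕ → ℝ} (hM : IsWeightSeq M) (j : ℕ) :
    M j ≤ (M (j + 1) / M j) ^ j := by
  induction j with
  | zero => simp [hM.zero]
  | succ j ih =>
    have h0 := hM.pos j
    have h1 := hM.pos (j + 1)
    calc M (j + 1) = M j * (M (j + 1) / M j) := by field_simp
      _ ≤ (M (j + 1) / M j) ^ j * (M (j + 1) / M j) := by gcongr
      _ = (M (j + 1) / M j) ^ (j + 1) := (pow_succ _ _).symm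
      _ ≤ (M (j + 1 + 1) / M (j + 1)) ^ (j + 1) := by
        exact pow_le_pow_left₀ (by positivity) (hM.quot_mono j) _

theorem IsWeightSeq.rootSeq_mono {M : ℕ → ℝ} (hM : IsWeightSeq M) : Monotone (rootSeq M) := by
  refine monotone_nat_of_le_succ fun j => ?_
  rcases Nat.eq_zero_or_pos j with rfl | hj
  · rw [rootSeq_zero]
    simpa [rootSeq] using hM.one_le
  have h0 := hM.pos j
  have h1 := hM.pos (j + 1)
  have h2 : M j ^ (j + 1) ≤ M (j + 1) ^ j := by
    calc M j ^ (j + 1) = M j ^ j * M j := pow_succ _ _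
      _ ≤ M j ^ j * (M (j + 1) / M j) ^ j := by gcongr; exact hM.le_quot_pow j
      _ = M (j + 1) ^ j := by rw [← mul_pow, mul_div_cancel₀ _ h0.ne']
  have hj' : (j : ℝ) ≠ 0 := by positivity
  have hj1 : (j : ℝ) + 1 ≠ 0 := by positivity
  have h3 := Real.rpow_le_rpow (by positivity) h2
    (by positivity : (0 : ℝ) ≤ 1 / ((j : ℝ) * ((j : ℝ) + 1)))
  rw [← Real.rpow_natCast, ← Real.rpow_natCast, ← Real.rpow_mul h0.le, ← Real.rpow_mul h1.le] at h3
  simp only [rootSeq]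
  convert! h3 using 2
  · push_cast; field_simp
  · push_cast; field_simp

theorem IsBaseSeq.exists_le_lt {k : ℕ → ℕ} (hk : IsBaseSeq k) (l : ℕ) :
    ∃ j, k j ≤ l ∧ l < k (j + 1) := by
  classical
  have hex : ∃ j, l < k j := ⟨l + 1, (Nat.lt_succ_self l).trans_le (hk.strictMono.le_apply)⟩
  obtain ⟨j, hj⟩ : ∃ j, Nat.find hex = j + 1 := by
    refine Nat.exists_eq_succ_of_ne_zero fun h => ?_
    have := Nat.find_spec hex
    rw [h, hk.zero] at this
    omega
  refine ⟨j, not_lt.1 (Nat.find_min hex (by omega)), ?_⟩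
  rw [← hj]
  exact Nat.find_spec hex

theorem exists_one_le_rootSeq_succ_le {k : ℕ → ℕ} {M : ℕ → ℝ} (hM : IsWeightSeq M)
    (hkM : BddAbove (range fun j : ℕ => rootSeq M (k (j + 1)) / rootSeq M (k j))) :
    ∃ A : ℝ, 1 ≤ A ∧ ∀ j, rootSeq M (k (j + 1)) ≤ A * rootSeq M (k j) := by
  obtain ⟨A, hA⟩ := hkM
  refine ⟨max 1 A, le_max_left _ _, fun j => ?_⟩
  have h := hA (mem_range_self j)
  rw [div_le_iff₀ (hM.rootSeq_pos _)] at h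
  exact h.trans (mul_le_mul_of_nonneg_right (le_max_right _ _) (hM.rootSeq_pos _).le)

theorem IsSpecialBaseSeq.exists_succ_le {k : ℕ → ℕ} (hk : IsSpecialBaseSeq k) :
    ∃ D : ℕ, 1 ≤ D ∧ ∀ j, 1 ≤ j → k (j + 1) ≤ D * k j := by
  obtain ⟨A, hA⟩ := hk.bdd
  obtain ⟨D, hD⟩ := exists_nat_ge A
  refine ⟨D + 1, by omega, fun j hj => ?_⟩
  have h := hA j hj
  have h0 : 0 < k j := by
    rw [← hk.zero]; exact hk.strictMono hj
  have h0' : (0 : ℝ) < k j := by exact_mod_cast h0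
  rw [div_le_iff₀ h0'] at h
  have : (k (j + 1) : ℝ) ≤ (D + 1 : ℕ) * k j := by
    refine h.trans ?_
    gcongr
    push_cast; linarith
  exact_mod_cast this

end WeightSequences

/-! ### From lacunary estimates to estimates of all orders. -/

section Estimates

variable {𝕜 : Type*} [RCLike 𝕜] {n : ℕ} {p : ℝ≥0∞} {M : ℕ → ℝ} {k : ℕ → ℕ}
  {f : EuclideanSpace ℝ (Fin n) → 𝕜} {C ρ A : ℝ}

theorem DCEstimates.mono_set {S S' : Set ℕ} {Ω : Set (EuclideanSpace ℝ (Fin n))}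
    (h : DCEstimates p M S' Ω f C ρ) (hS : S ⊆ S') : DCEstimates p M S Ω f C ρ :=
  fun α hα => h α (hS hα)

theorem DCEstimates.mono_right (hM : IsWeightSeq M) {S : Set ℕ}
    {Ω : Set (EuclideanSpace ℝ (Fin n))} (hC : 0 < C) (hρ : 0 < ρ) {ρ' : ℝ} (hρ' : ρ ≤ ρ')
    (h : DCEstimates p M S Ω f C ρ) : DCEstimates p M S Ω f C ρ' := by
  intro α hα
  refine (h α hα).trans (ENNReal.ofReal_le_ofReal ?_)
  have := hM.rootSeq_pos (multiOrder α)
  gcongr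

theorem DCEstimates.eLpNorm_le_pow (hM : IsWeightSeq M) {S : Set ℕ}
    {Ω : Set (EuclideanSpace ℝ (Fin n))} (hC : 0 < C) (hρ : 0 < ρ)
    (h : DCEstimates p M S Ω f C ρ) {l : ℕ} (hl : l ∈ S) {T : ℝ} (hT : ρ * rootSeq M l ≤ T)
    {α : Fin n → ℕ} (hα : multiOrder α = l) :
    eLpNorm (multiDeriv α f) p (volume.restrict Ω) ≤ ENNReal.ofReal (T ^ l) * ENNReal.ofReal C := by
  subst hα
  have h0 := hM.rootSeq_pos (multiOrder α)
  have hT0 : 0 < T := lt_of_lt_of_le (by positivity) hT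
  rw [← ENNReal.ofReal_mul (by positivity), mul_comm]
  refine (h α hl).trans (ENNReal.ofReal_le_ofReal ?_)
  gcongr

theorem DCEstimates.univ_of_range_global (hp : 1 ≤ p) (hk : IsBaseSeq k) (hM : IsWeightSeq M)
    (hA1 : 1 ≤ A) (hA : ∀ j, rootSeq M (k (j + 1)) ≤ A * rootSeq M (k j)) (hf : ContDiff ℝ ∞ f)
    (hC : 0 < C) (hρ : 0 < ρ) (h : DCEstimates p M (range k) univ f C ρ) :
    DCEstimates p M univ univ f C (20000 * A * ρ) := by
  intro α _
  obtain ⟨j, hj1, hj2⟩ := hk.exists_le_lt (multiOrder α)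
  set l := multiOrder α with hl
  have hpos := hM.rootSeq_pos (k j)
  -- One `T` valid at both orders `k j` and `k (j + 1)`.
  set T := A * ρ * rootSeq M (k j) with hT
  have hT0 : 0 < T := by positivity
  have hTa : ρ * rootSeq M (k j) ≤ T := by
    rw [hT, mul_assoc]
    exact le_mul_of_one_le_left (by positivity) hA1
  have hTb : ρ * rootSeq M (k (j + 1)) ≤ T := by
    calc ρ * rootSeq M (k (j + 1)) ≤ ρ * (A * rootSeq M (k j)) := by gcongr; exact hA j
      _ = T := by rw [hT]; ring
  have hkj : k j + (k (j + 1) - k j) = k (j + 1) := by omega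
  have key := eLpNorm_multiDeriv_le_of_global hf hp hT0 (a := k j) (M := k (j + 1) - k j)
    (q := ENNReal.ofReal C)
    (fun β hβ => by simpa using h.eLpNorm_le_pow hM hC hρ (mem_range_self j) hTa hβ)
    (fun β hβ => by
      rw [hkj] at hβ ⊢
      simpa using h.eLpNorm_le_pow hM hC hρ (mem_range_self (j + 1)) hTb hβ)
    (i := l - k j) (by omega) (α := α) (by omega)
  rw [Measure.restrict_univ]
  refine key.trans ?_
  rw [← ENNReal.ofReal_mul (by positivity), mul_comm]
  refine ENNReal.ofReal_le_ofReal ?_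
  rw [Nat.add_sub_cancel' hj1]
  have hmono : rootSeq M (k j) ≤ rootSeq M l := hM.rootSeq_mono hj1
  calc C * ((20000 : ℝ) ^ (l - k j) * T ^ l) ≤ C * (20000 ^ l * T ^ l) := by
        gcongr
        · norm_num
        · exact Nat.sub_le _ _
    _ = C * (20000 * A * ρ * rootSeq M (k j)) ^ l := by
        rw [← mul_pow, hT]; ring
    _ ≤ C * (20000 * A * ρ * rootSeq M l) ^ l := by gcongr

theorem DCEstimates.local_le (hp : 1 ≤ p) (hk : IsBaseSeq k) (hM : IsWeightSeq M)
    (hA1 : 1 ≤ A) (hA : ∀ j, rootSeq M (k (j + 1)) ≤ A * rootSeq M (k j))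
    {D : ℕ} (hD : ∀ j, 1 ≤ j → k (j + 1) ≤ D * k j)
    {U V Ω : Set (EuclideanSpace ℝ (Fin n))} (hU : IsOpen U) (hf : ContDiffOn ℝ ∞ f U)
    (hVU : V ⊆ U) (hΩ : IsOpen Ω) {δ : ℝ} (hΩV : Metric.thickening ((n + 1) * δ) Ω ⊆ V)
    (hC : 0 < C) (hρ : 0 < ρ) (h : DCEstimates p M (range k) V f C ρ) {j : ℕ}
    (hjδ : ((k (j + 1) - k j : ℕ) : ℝ) < δ * (A * ρ * rootSeq M (k j))) {α : Fin n → ℕ}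
    (hj1 : k j ≤ multiOrder α) (hj2 : multiOrder α < k (j + 1)) :
    eLpNorm (multiDeriv α f) p (volume.restrict Ω) ≤ ENNReal.ofReal (72 ^ (k 1 * n) * C *
      (72 ^ (D * n) * A * ρ * rootSeq M (multiOrder α)) ^ multiOrder α) := by
  set l := multiOrder α with hl
  have hpos := hM.rootSeq_pos (k j)
  set T := A * ρ * rootSeq M (k j) with hT
  have hT0 : 0 < T := by positivity
  have hTa : ρ * rootSeq M (k j) ≤ T := by
    rw [hT, mul_assoc]
    exact le_mul_of_one_le_left (by positivity) hA1
  have hTb : ρ * rootSeq M (k (j + 1)) ≤ T := by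
    calc ρ * rootSeq M (k (j + 1)) ≤ ρ * (A * rootSeq M (k j)) := by gcongr; exact hA j
      _ = T := by rw [hT]; ring
  have hkj : k j + (k (j + 1) - k j) = k (j + 1) := by omega
  have key := eLpNorm_multiDeriv_le_of_local hU hf hVU hp hT0 (a := k j) (M := k (j + 1) - k j)
    (q := ENNReal.ofReal C) (by rwa [div_lt_iff₀ hT0])
    (fun β hβ => h.eLpNorm_le_pow hM hC hρ (mem_range_self j) hTa hβ)
    (fun β hβ => by
      rw [hkj] at hβ ⊢
      exact h.eLpNorm_le_pow hM hC hρ (mem_range_self (j + 1)) hTb hβ)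
    hΩ hΩV (i := l - k j) (by omega) (α := α) (by omega)
  refine key.trans ?_
  rw [← ENNReal.ofReal_mul (by positivity), mul_comm]
  refine ENNReal.ofReal_le_ofReal ?_
  rw [Nat.add_sub_cancel' hj1]
  have hmono : rootSeq M (k j) ≤ rootSeq M l := hM.rootSeq_mono hj1
  -- The gap is linear in `l`; the term `k 1` covers `j = 0`, about which specialness says nothing.
  -- It enters the constant, while `D * l` enters `ρ`.
  have hexp : k (j + 1) - k j ≤ k 1 + D * l := by
    rcases Nat.eq_zero_or_pos j with rfl | hj
    · rw [hk.zero]; simp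
    · have h1 := hD j hj
      have h2 : D * k j ≤ D * l := Nat.mul_le_mul_left _ hj1
      omega
  calc C * ((72 : ℝ) ^ ((k (j + 1) - k j) * n) * T ^ l)
      ≤ C * (72 ^ ((k 1 + D * l) * n) * T ^ l) := by
        gcongr
        norm_num
    _ = 72 ^ (k 1 * n) * C * (72 ^ (D * n) * A * ρ * rootSeq M (k j)) ^ l := by
        rw [add_mul, pow_add, show D * l * n = D * n * l by ring, pow_mul _ (D * n),
          hT, show (72 : ℝ) ^ (D * n) * A * ρ * rootSeq M (k j) =
            72 ^ (D * n) * (A * ρ * rootSeq M (k j)) by ring, mul_pow _ (A * ρ * rootSeq M (k j))]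
        ring
    _ ≤ 72 ^ (k 1 * n) * C * (72 ^ (D * n) * A * ρ * rootSeq M l) ^ l := by gcongr

theorem DCEstimates.roumieu_local (hp : 1 ≤ p) (hk : IsSpecialBaseSeq k) (hM : IsWeightSeq M)
    (hA1 : 1 ≤ A) (hA : ∀ j, rootSeq M (k (j + 1)) ≤ A * rootSeq M (k j))
    (hbdd : BddAbove (range fun j : ℕ => (j : ℝ) / rootSeq M j))
    {U V Ω : Set (EuclideanSpace ℝ (Fin n))} (hU : IsOpen U) (hf : ContDiffOn ℝ ∞ f U)
    (hVU : V ⊆ U) (hΩ : IsOpen Ω) {δ : ℝ} (hδ : 0 < δ)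
    (hΩV : Metric.thickening ((n + 1) * δ) Ω ⊆ V)
    (hC : 0 < C) (hρ : 0 < ρ) (h : DCEstimates p M (range k) V f C ρ) :
    DCType.roumieu.Constants (DCEstimates p M univ Ω f) := by
  obtain ⟨D, hD1, hD⟩ := hk.exists_succ_le
  obtain ⟨H, hH⟩ := hbdd
  have hH' : ∀ i : ℕ, (i : ℝ) ≤ H * rootSeq M i := fun i => by
    have := hH (mem_range_self i)
    rwa [div_le_iff₀ (hM.rootSeq_pos i)] at this
  have hH0 : 0 ≤ H := by simpa using hH (mem_range_self 0)
  -- Enlarging `ρ` shortens the step `1 / T`. This choice makes every gap fit into the room `δ`,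
  -- strictly because `ρ > 0`.
  set ρ' := ρ + (D * H + k 1) / δ with hρ'
  have hle : ρ ≤ ρ' := le_add_of_nonneg_right (by positivity)
  have hρ'0 : 0 < ρ' := hρ.trans_le hle
  refine ⟨72 ^ (k 1 * n) * C, by positivity, 72 ^ (D * n) * A * ρ', by positivity, fun α _ => ?_⟩
  obtain ⟨j, hj1, hj2⟩ := hk.toIsBaseSeq.exists_le_lt (multiOrder α)
  refine (h.mono_right hM hC hρ hle).local_le hp hk.toIsBaseSeq hM hA1 hA hD hU hf hVU hΩ hΩV hC
    hρ'0 ?_ hj1 hj2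
  have hpos := hM.rootSeq_pos (k j)
  have h1 : ((k (j + 1) - k j : ℕ) : ℝ) ≤ (D * H + k 1) * rootSeq M (k j) := by
    rcases Nat.eq_zero_or_pos j with rfl | hj
    · rw [hk.zero, rootSeq_zero]
      simp only [Nat.sub_zero, zero_add, mul_one]
      exact le_add_of_nonneg_left (by positivity)
    · calc ((k (j + 1) - k j : ℕ) : ℝ) ≤ (D * k j : ℕ) := by
            exact_mod_cast (Nat.sub_le _ _).trans (hD j hj)
        _ ≤ D * (H * rootSeq M (k j)) := by push_cast; gcongr; exact hH' _
        _ ≤ (D * H + k 1) * rootSeq M (k j) := by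
            rw [add_mul, mul_assoc]
            exact le_add_of_nonneg_right (by positivity)
  calc ((k (j + 1) - k j : ℕ) : ℝ) ≤ (D * H + k 1) * rootSeq M (k j) := h1
    _ < (δ * ρ + (D * H + k 1)) * rootSeq M (k j) := by
        have : 0 < δ * ρ := by positivity
        exact mul_lt_mul_of_pos_right (by linarith) hpos
    _ = 1 * (δ * ρ' * rootSeq M (k j)) := by rw [hρ']; field_simp
    _ ≤ A * (δ * ρ' * rootSeq M (k j)) := by gcongr
    _ = δ * (A * ρ' * rootSeq M (k j)) := by ring

/-- Here `ρ` cannot be enlarged. Since `j / m_j → 0`, the gaps fit into `δ` once `k j` is large; the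
finitely many remaining orders are handled by the Roumieu estimate obtained from `ρ = 1`, at the
cost of a larger constant. -/
theorem DCEstimates.beurling_local (hp : 1 ≤ p) (hk : IsSpecialBaseSeq k) (hM : IsWeightSeq M)
    (hA1 : 1 ≤ A) (hA : ∀ j, rootSeq M (k (j + 1)) ≤ A * rootSeq M (k j))
    (hlim : Tendsto (fun j : ℕ => (j : ℝ) / rootSeq M j) atTop (𝓝 0))
    {U V Ω : Set (EuclideanSpace ℝ (Fin n))} (hU : IsOpen U) (hf : ContDiffOn ℝ ∞ f U)
    (hVU : V ⊆ U) (hΩ : IsOpen Ω) {δ : ℝ} (hδ : 0 < δ)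
    (hΩV : Metric.thickening ((n + 1) * δ) Ω ⊆ V)
    (h : DCType.beurling.Constants (DCEstimates p M (range k) V f)) :
    DCType.beurling.Constants (DCEstimates p M univ Ω f) := by
  obtain ⟨C₀, hC₀, h₀⟩ := h 1 one_pos
  obtain ⟨C₂, hC₂, ρ₂, hρ₂, h₂⟩ := h₀.roumieu_local hp hk hM hA1 hA hlim.bddAbove_range hU hf hVU hΩ
    hδ hΩV hC₀ one_pos
  obtain ⟨D, hD1, hD⟩ := hk.exists_succ_le
  intro ρ' hρ'
  set ρ := ρ' / (72 ^ (D * n) * A) with hρdef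
  have hρ : 0 < ρ := by positivity
  have hρρ' : 72 ^ (D * n) * A * ρ = ρ' := by rw [hρdef]; field_simp
  obtain ⟨C, hC, hest⟩ := h ρ hρ
  have hD0 : (0 : ℝ) < D := by exact_mod_cast hD1
  obtain ⟨I, hI⟩ := eventually_atTop.1
    (hlim.eventually (gt_mem_nhds (show 0 < δ * (A * ρ) / D by positivity)))
  -- An upper bound for all orders below `k (j + 1)` when `k j ≤ I`. On these, replacing `ρ₂` by
  -- `ρ'` costs at most `B ^ L`.
  set L := D * (I + 1) + k 1 with hL
  set B := max 1 (ρ₂ / ρ') with hB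
  have hB1 : 1 ≤ B := le_max_left _ _
  refine ⟨72 ^ (k 1 * n) * C + C₂ * B ^ L, by positivity, fun α _ => ?_⟩
  have hl0 := hM.rootSeq_pos (multiOrder α)
  obtain ⟨j, hj1, hj2⟩ := hk.toIsBaseSeq.exists_le_lt (multiOrder α)
  by_cases hjI : I + 1 ≤ k j
  · have hj0 : 1 ≤ j := by
      rw [Nat.one_le_iff_ne_zero]
      rintro rfl
      rw [hk.zero] at hjI
      omega
    have hpos := hM.rootSeq_pos (k j)
    have h1 := hI (k j) (by omega)
    rw [div_lt_iff₀ hpos] at h1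
    refine (hest.local_le hp hk.toIsBaseSeq hM hA1 hA hD hU hf hVU hΩ hΩV hC hρ ?_ hj1 hj2).trans
      (ENNReal.ofReal_le_ofReal ?_)
    · calc ((k (j + 1) - k j : ℕ) : ℝ) ≤ (D * k j : ℕ) := by
            exact_mod_cast (Nat.sub_le _ _).trans (hD j hj0)
        _ = D * (k j : ℝ) := by push_cast; rfl
        _ < D * (δ * (A * ρ) / D * rootSeq M (k j)) := by gcongr
        _ = δ * (A * ρ * rootSeq M (k j)) := by field_simp
    · rw [hρρ']
      gcongr
      exact le_add_of_nonneg_right (by positivity)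
  · have hlL : multiOrder α ≤ L := by
      rcases Nat.eq_zero_or_pos j with rfl | hj
      · simp only [zero_add] at hj2
        omega
      · have h1 := hD j hj
        have h2 : D * k j ≤ D * (I + 1) := Nat.mul_le_mul_left _ (by omega)
        omega
    refine (h₂ α (mem_univ _)).trans (ENNReal.ofReal_le_ofReal ?_)
    have h3 : ρ₂ ≤ B * ρ' := by
      rw [← div_le_iff₀ hρ']
      exact le_max_right _ _
    calc C₂ * (ρ₂ * rootSeq M (multiOrder α)) ^ multiOrder α
        ≤ C₂ * (B * ρ' * rootSeq M (multiOrder α)) ^ multiOrder α := by gcongr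
      _ = C₂ * B ^ multiOrder α * (ρ' * rootSeq M (multiOrder α)) ^ multiOrder α := by
          rw [mul_assoc B, mul_pow]; ring
      _ ≤ C₂ * B ^ L * (ρ' * rootSeq M (multiOrder α)) ^ multiOrder α := by gcongr
      _ ≤ _ := by
          gcongr
          exact le_add_of_nonneg_left (by positivity)

end Estimates

/-! ### Equality of the function classes. -/

section Classes

variable {𝕜 : Type*} [RCLike 𝕜] {n : ℕ} {p : ℝ≥0∞} {M : ℕ → ℝ} {k : ℕ → ℕ}

theorem DCType.Constants.mono {t : DCType} {P Q : ℝ → ℝ → Prop} (h : t.Constants P)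
    (hPQ : ∀ C ρ, P C ρ → Q C ρ) : t.Constants Q := by
  cases t with
  | roumieu =>
    obtain ⟨C, hC, ρ, hρ, hP⟩ := h
    exact ⟨C, hC, ρ, hρ, hPQ _ _ hP⟩
  | beurling =>
    intro ρ hρ
    obtain ⟨C, hC, hP⟩ := h ρ hρ
    exact ⟨C, hC, hPQ _ _ hP⟩

theorem DCType.Constants.of_scaling {t : DCType} {P Q : ℝ → ℝ → Prop} (h : t.Constants P)
    {B : ℝ} (hB : 0 < B) (hPQ : ∀ C ρ, 0 < C → 0 < ρ → P C ρ → Q C (B * ρ)) : t.Constants Q := by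
  cases t with
  | roumieu =>
    obtain ⟨C, hC, ρ, hρ, hP⟩ := h
    exact ⟨C, hC, B * ρ, by positivity, hPQ _ _ hC hρ hP⟩
  | beurling =>
    intro ρ hρ
    obtain ⟨C, hC, hP⟩ := h (ρ / B) (by positivity)
    refine ⟨C, hC, ?_⟩
    have := hPQ _ _ hC (by positivity) hP
    rwa [mul_div_cancel₀ _ hB.ne'] at this

theorem lacunaryB_eq_classB (hp : 1 ≤ p) (hk : IsBaseSeq k) (hM : IsWeightSeq M)
    (hkM : BddAbove (range fun j : ℕ => rootSeq M (k (j + 1)) / rootSeq M (k j))) (t : DCType) :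
    lacunaryB 𝕜 n t p M k = classB 𝕜 n t p M := by
  obtain ⟨A, hA1, hA⟩ := exists_one_le_rootSeq_succ_le hM hkM
  refine Subset.antisymm (fun f hf => ⟨hf.1, ?_⟩) fun f hf =>
    ⟨hf.1, hf.2.mono fun C ρ h => h.mono_set (subset_univ _)⟩
  exact hf.2.of_scaling (B := 20000 * A) (by positivity) fun C ρ hC hρ h =>
    h.univ_of_range_global hp hk hM hA1 hA hf.1 hC hρ

theorem classE_subset_lacunaryE (t : DCType) (U : Set (EuclideanSpace ℝ (Fin n))) :
    classE 𝕜 t p M U ⊆ lacunaryE 𝕜 t p M k U := fun _ hf =>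
  ⟨hf.1, fun Ω hΩ hc hs => (hf.2 Ω hΩ hc hs).mono fun _ _ h => h.mono_set (subset_univ _)⟩

/-- A relatively compact open subset has a relatively compact open thickening. -/
theorem exists_thickening_relatively_compact {U Ω : Set (EuclideanSpace ℝ (Fin n))}
    (hU : IsOpen U) (hc : IsCompact (closure Ω)) (hs : closure Ω ⊆ U) :
    ∃ (δ : ℝ) (V : Set (EuclideanSpace ℝ (Fin n))), 0 < δ ∧ IsOpen V ∧ IsCompact (closure V) ∧
      closure V ⊆ U ∧ Metric.thickening ((n + 1) * δ) Ω ⊆ V := by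
  obtain ⟨ε, hε, hεU⟩ := hc.exists_cthickening_subset_open hU hs
  have hcl : closure (Metric.thickening ε Ω) ⊆ Metric.cthickening ε (closure Ω) :=
    (Metric.closure_thickening_subset_cthickening _ _).trans
      (Metric.cthickening_subset_of_subset _ subset_closure)
  refine ⟨ε / (n + 1), Metric.thickening ε Ω, by positivity, Metric.isOpen_thickening,
    hc.cthickening.of_isClosed_subset isClosed_closure hcl, hcl.trans hεU, ?_⟩
  rw [mul_div_cancel₀ _ (by positivity)]

theorem lacunaryE_roumieu_eq_classE (hp : 1 ≤ p) (hk : IsSpecialBaseSeq k) (hM : IsWeightSeq M)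
    (hkM : BddAbove (range fun j : ℕ => rootSeq M (k (j + 1)) / rootSeq M (k j)))
    {U : Set (EuclideanSpace ℝ (Fin n))} (hU : IsOpen U)
    (hbdd : BddAbove (range fun j : ℕ => (j : ℝ) / rootSeq M j)) :
    lacunaryE 𝕜 DCType.roumieu p M k U = classE 𝕜 DCType.roumieu p M U := by
  obtain ⟨A, hA1, hA⟩ := exists_one_le_rootSeq_succ_le hM hkM
  refine Subset.antisymm (fun f hf => ⟨hf.1, fun Ω hΩ hc hs => ?_⟩) (classE_subset_lacunaryE _ _)
  obtain ⟨δ, V, hδ, hV, hVc, hVU, hΩV⟩ := exists_thickening_relatively_compact hU hc hs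
  obtain ⟨C, hC, ρ, hρ, h⟩ := hf.2 V hV hVc hVU
  exact h.roumieu_local hp hk hM hA1 hA hbdd hU hf.1 (subset_closure.trans hVU) hΩ hδ hΩV hC hρ

theorem lacunaryE_beurling_eq_classE (hp : 1 ≤ p) (hk : IsSpecialBaseSeq k) (hM : IsWeightSeq M)
    (hkM : BddAbove (range fun j : ℕ => rootSeq M (k (j + 1)) / rootSeq M (k j)))
    {U : Set (EuclideanSpace ℝ (Fin n))} (hU : IsOpen U)
    (hlim : Tendsto (fun j : ℕ => (j : ℝ) / rootSeq M j) atTop (𝓝 0)) :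
    lacunaryE 𝕜 DCType.beurling p M k U = classE 𝕜 DCType.beurling p M U := by
  obtain ⟨A, hA1, hA⟩ := exists_one_le_rootSeq_succ_le hM hkM
  refine Subset.antisymm (fun f hf => ⟨hf.1, fun Ω hΩ hc hs => ?_⟩) (classE_subset_lacunaryE _ _)
  obtain ⟨δ, V, hδ, hV, hVc, hVU, hΩV⟩ := exists_thickening_relatively_compact hU hc hs
  exact DCEstimates.beurling_local hp hk hM hA1 hA hlim hU hf.1 (subset_closure.trans hVU) hΩ hδ hΩV
    (hf.2 V hV hVc hVU)

end Classes
end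

theorem mainTheorem1 {𝕜 : Type*} [RCLike 𝕜] (n : ℕ) (p : ℝ≥0∞) (hp : 1 ≤ p)
    (k : ℕ → ℕ) (hk : IsBaseSeq k) (M : ℕ → ℝ) (hM : IsWeightSeq M)
    (hkM : BddAbove (range fun j : ℕ => rootSeq M (k (j + 1)) / rootSeq M (k j))) :
    (∀ t : DCType, lacunaryB 𝕜 n t p M k = classB 𝕜 n t p M) ∧
    (∀ t : DCType, lacunaryD 𝕜 n t M k = classD 𝕜 n t M) ∧
    (IsSpecialBaseSeq k → ∀ U : Set (EuclideanSpace ℝ (Fin n)), IsOpen U →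
      (BddAbove (range fun j : ℕ => (j : ℝ) / rootSeq M j) →
        lacunaryE 𝕜 DCType.roumieu p M k U = classE 𝕜 DCType.roumieu p M U) ∧
      (Tendsto (fun j : ℕ => (j : ℝ) / rootSeq M j) atTop (𝓝 0) →
        lacunaryE 𝕜 DCType.beurling p M k U = classE 𝕜 DCType.beurling p M U)) := by
  refine ⟨lacunaryB_eq_classB hp hk hM hkM, fun t => ?_, fun hks U hU =>
    ⟨lacunaryE_roumieu_eq_classE hp hks hM hkM hU, lacunaryE_beurling_eq_classE hp hks hM hkM hU⟩⟩
  rw [lacunaryD, classD, lacunaryB_eq_classB le_top hk hM hkM]
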